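/- Let $M$ be a smooth manifold, $n\ge 1$, and let $(M,\omega,H)$ be a multi-Hamiltonian system: $\omega\in\Omega^{n+1}(M)$ is $n$-plectic, i.e. closed and such that $v\mapsto v\lrcorner\,\omega$ is injective on every tangent space, $H\in\Omega^{n-1}(M)$, and $X_H$ is a vector field with $dH=-X_H\lrcorner\,\omega$. Conventions. For vector fields $X_1,\dots,X_k$ and a form $\tau$ let $(X_1\wedge\cdots\wedge X_k)\lrcorner\,\tau=X_k\lrcorner\cdots X_1\lrcorner\,\tau$, extended linearly to all $k$-vector fields $X\in\Gamma(\Lambda^kTM)$, and let $\mathcal L_X\tau=d(X\lrcorner\,\tau)-(-1)^kX\lrcorner\,d\tau$. The Schouten bracket $[\cdot,\cdot]:\Gamma(\Lambda^kTM)\times\Gamma(\Lambda^lTM)\to\Gamma(\Lambda^{k+l-1}TM)$ ($k,l\ge1$) is the linear extension of $$[X_1\wedge\cdots\wedge X_k,\,Y_1\wedge\cdots\wedge Y_l]=\sum_{i,j}(-1)^{i+j}[X_i,Y_j]\wedge X_1\wedge\cdots\widehat{X_i}\cdots\wedge X_k\wedge Y_1\wedge\cdots\widehat{Y_j}\cdots\wedge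 Y_l .$$ With $k$-vector fields in degree $k-1$, a graded Lie bracket is a bilinear bracket, additive in degrees, with $[x,y]=-(-1)^{|x||y|}[y,x]$ and $(-1)^{|x||z|}[x,[y,z]]+(-1)^{|y||x|}[y,[z,x]]+(-1)^{|z||y|}[z,[x,y]]=0$. For $k\ge1$, a form $\alpha\in\Omega^{n-k}(M)$ is Hamiltonian if $d\alpha=-X_\alpha\lrcorner\,\omega$ for some $X_\alpha\in\Gamma(\Lambda^kTM)$ (a Hamiltonian $k$-vector field of $\alpha$); a $k$-vector field $X$ is Hamiltonian if $X\lrcorner\,\omega$ is exact. For Hamiltonian $\alpha\in\Omega^{n-k}(M)$, $\beta\in\Omega^{n-l}(M)$ put $\{\alpha,\beta\}=(-1)^{l+1}X_\beta\lrcorner X_\alpha\lrcorner\,\omega$; an $(n-k)$-form has degree $k-1$ for this bracket. A Hamiltonian form $\alpha$ is a local (resp. global) conserved quantity if $\mathcal L_{X_H}\alpha$ is closed (resp. exact). A Hamiltonian multivector field $X$ is a local (resp. global, strict) continuous symmetry if $\mathcal L_XH$ is closed (resp. exact, zero). Let $\mathcal C_{\rm loc}(X_H)$, $\mathcal C(X_H)$,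 and $\mathcal S_{\rm loc}(H)$, $\mathcal S(H)$, $\mathcal S_{\rm str}(H)$ be the corresponding graded vector spaces; let $\widetilde{\mathcal C}_{\rm loc}(X_H)$, $\widetilde{\mathcal C}(X_H)$ be the quotients by the closed forms, and $\widetilde{\mathcal S}_{\rm loc}(H)$, $\widetilde{\mathcal S}(H)$ the quotients by $\ker\omega=\{\kappa:\kappa\lrcorner\,\omega=0\}$. (An exact $0$-form is zero.) Theorem. (1) The Schouten bracket is a graded Lie bracket on the multivector fields of degree $k\ge1$; the Hamiltonian multivector fields form a graded Lie subalgebra, and $\mathcal S_{\rm loc}(H)$, $\mathcal S(H)$ and $\mathcal S_{\rm str}(H)$ are graded Lie subalgebras of it. (2) $\mathcal C(X_H)$ and $\mathcal C_{\rm loc}(X_H)$ are closed under $\{\cdot,\cdot\}$, whatever Hamiltonian multivector fields are used to compute it, and $\{\cdot,\cdot\}$ and $[\cdot,\cdot]$ descend to graded Lie brackets on $\widetilde{\mathcal C}(X_H)$, $\widetilde{\mathcal C}_{\rm loc}(X_H)$ and on $\widetilde{\mathcal S}(H)$, $\widetilde{\mathcal S}_{\rm loc}(H)$. (3) If $\alpha$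 is a global (resp. local) conserved quantity, then each of its Hamiltonian multivector fields $X_\alpha$ is a global (resp. local) continuous symmetry, and $[\alpha]\mapsto[X_\alpha]$ is a well-defined isomorphism of graded Lie algebras $$(\widetilde{\mathcal C}(X_H),\{\cdot,\cdot\})\to(\widetilde{\mathcal S}(H),[\cdot,\cdot]),\qquad\text{resp.}\qquad(\widetilde{\mathcal C}_{\rm loc}(X_H),\{\cdot,\cdot\})\to(\widetilde{\mathcal S}_{\rm loc}(H),[\cdot,\cdot]).$$ -/

import Mathlib

open scoped Manifold ContDiff Topology Bundle
open Set Filter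

set_option linter.unusedSectionVars false

noncomputable section

namespace Multisymplectic

section Analysis

variable {E : Type*} [NormedAddCommGroup E] [NormedSpace ℝ E] [FiniteDimensional ℝ E]
  {G : Type*} [NormedAddCommGroup G] [NormedSpace ℝ G]

theorem contDiffWithinAt_alternating {q : ℕ} {f : G → E [⋀^Fin q]→L[ℝ] ℝ} {s : Set G} {y : G}
    {r : WithTop ℕ∞} (h : ∀ w : Fin q → E, ContDiffWithinAt ℝ r (fun z => f z w) s y) :
    ContDiffWithinAt ℝ r f s y := by
  let b := Module.finBasis ℝ E
  let ev : (E [⋀^Fin q]→L[ℝ] ℝ) →ₗ[ℝ] ((Fin q → Fin (Module.finrank ℝ E)) → ℝ) :=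
    { toFun := fun L σ => L (fun i => b (σ i))
      map_add' := fun _ _ => rfl
      map_smul' := fun _ _ => rfl }
  have hev : LinearMap.ker ev = ⊥ := by
    rw [LinearMap.ker_eq_bot']
    intro L hL
    apply ContinuousAlternatingMap.toAlternatingMap_injective
    refine Module.Basis.ext_alternating b fun v _ => ?_
    exact congrFun hL v
  obtain ⟨g, hg⟩ := ev.exists_leftInverse_of_injective hev
  have hfg : f = fun z => (LinearMap.toContinuousLinearMap g) (ev (f z)) := by
    funext z
    exact (LinearMap.congr_fun hg (f z)).symm
  rw [hfg]
  refine (LinearMap.toContinuousLinearMap g).contDiff.contDiffAt.comp_contDiffWithinAt y ?_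
  rw [contDiffWithinAt_pi]
  exact fun σ => h _

theorem contDiffWithinAt_alternating_apply {q : ℕ} {f : G → E [⋀^Fin q]→L[ℝ] ℝ}
    {u : Fin q → G → E} {s : Set G} {y : G} {r : WithTop ℕ∞} (hf : ContDiffWithinAt ℝ r f s y)
    (hu : ∀ i, ContDiffWithinAt ℝ r (u i) s y) :
    ContDiffWithinAt ℝ r (fun z => f z (fun i => u i z)) s y := by
  let b := Module.finBasis ℝ E
  have key : ∀ z, f z (fun i => u i z) =
      ∑ σ : Fin q → Fin (Module.finrank ℝ E),
        (∏ i, b.repr (u i z) (σ i)) * f z (fun i => b (σ i)) := by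
    intro z
    have h1 : (fun i => u i z) = fun i => ∑ j, b.repr (u i z) j • b j := by
      funext i; exact (b.sum_repr _).symm
    conv_lhs => rw [h1]
    have := (f z).toMultilinearMap.map_sum (fun i j => b.repr (u i z) j • b j)
    refine this.trans (Finset.sum_congr rfl fun σ _ => ?_)
    exact (f z).toMultilinearMap.map_smul_univ _ _
  simp_rw [key]
  refine ContDiffWithinAt.sum fun σ _ => ContDiffWithinAt.mul (contDiffWithinAt_prod fun i _ => ?_) ?_
  · have : ContDiff ℝ r (LinearMap.toContinuousLinearMap (b.coord (σ i))) :=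
      (LinearMap.toContinuousLinearMap (b.coord (σ i))).contDiff
    exact this.contDiffAt.comp_contDiffWithinAt y (hu i)
  · let A : (E [⋀^Fin q]→L[ℝ] ℝ) →L[ℝ] ℝ :=
      ContinuousAlternatingMap.apply ℝ E ℝ (fun i => b (σ i))
    exact A.contDiff.contDiffAt.comp_contDiffWithinAt y hf

end Analysis

variable {E : Type*} [NormedAddCommGroup E] [NormedSpace ℝ E] [FiniteDimensional ℝ E]
  {M : Type*} [TopologicalSpace M] [ChartedSpace E M] [IsManifold 𝓘(ℝ, E) ∞ M]


variable (E M) in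
/-- Smooth vector fields on `M`. -/
abbrev VecField := Cₛ^∞⟮𝓘(ℝ, E); E, (TangentSpace 𝓘(ℝ, E) : M → Type _)⟯

variable (E M) in
/-- Smooth differential `p`-forms on `M`: smooth sections of the bundle of alternating `p`-linear
forms on the tangent bundle. -/
abbrev Form (p : ℕ) : Type _ :=
  Cₛ^∞⟮𝓘(ℝ, E); E [⋀^Fin p]→L[ℝ] ℝ,
    (fun x : M => TangentSpace 𝓘(ℝ, E) x [⋀^Fin p]→L[ℝ] Bundle.Trivial M ℝ x)⟯

/-- The expression of a `p`-form in the chart at `x₀`: its pullback under the inverse chart. -/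
def chartRep {p : ℕ} (x₀ : M) (τ : ∀ x : M, TangentSpace 𝓘(ℝ, E) x [⋀^Fin p]→L[ℝ] ℝ) (y : E) :
    E [⋀^Fin p]→L[ℝ] ℝ :=
  (τ ((extChartAt 𝓘(ℝ, E) x₀).symm y)).compContinuousLinearMap
    (mfderiv 𝓘(ℝ, E) 𝓘(ℝ, E) (extChartAt 𝓘(ℝ, E) x₀).symm y :)

/-- The exterior derivative at `x`: take it in the chart at `x` and pull it back to `M`. It is
computed by every other chart as well (`Form.chartRep_extDerivAt`). -/
def extDerivAt {p : ℕ} (τ : ∀ x : M, TangentSpace 𝓘(ℝ, E) x [⋀^Fin p]→L[ℝ] ℝ) (x : M) :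
    TangentSpace 𝓘(ℝ, E) x [⋀^Fin (p + 1)]→L[ℝ] ℝ :=
  (extDeriv (chartRep x τ) (extChartAt 𝓘(ℝ, E) x x)).compContinuousLinearMap
    (mfderiv 𝓘(ℝ, E) 𝓘(ℝ, E) (extChartAt 𝓘(ℝ, E) x) x :)


theorem trivialization_eq_chartRep {p : ℕ} (x₀ : M)
    (τ : ∀ x : M, TangentSpace 𝓘(ℝ, E) x [⋀^Fin p]→L[ℝ] Bundle.Trivial M ℝ x)
    {x : M} (hx : x ∈ (extChartAt 𝓘(ℝ, E) x₀).source) :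
    (trivializationAt (E [⋀^Fin p]→L[ℝ] ℝ)
      (fun x : M => TangentSpace 𝓘(ℝ, E) x [⋀^Fin p]→L[ℝ] Bundle.Trivial M ℝ x) x₀ ⟨x, τ x⟩).2 =
      chartRep x₀ τ (extChartAt 𝓘(ℝ, E) x₀ x) := by
  have hx' : x ∈ (chartAt E x₀).source := by simpa using hx
  have h1 := TangentBundle.symmL_trivializationAt (I := 𝓘(ℝ, E)) hx'
  rw [ModelWithCorners.Boundaryless.range_eq_univ, mfderivWithin_univ] at h1
  rw [FiberBundle.trivializationAt_continuousAlternatingMap_apply]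
  ext v
  have h2 : (extChartAt 𝓘(ℝ, E) x₀).symm (extChartAt 𝓘(ℝ, E) x₀ x) = x :=
    (extChartAt 𝓘(ℝ, E) x₀).left_inv hx
  have key : ∀ (x' : M) (h : x' = x) (D : E →L[ℝ] TangentSpace 𝓘(ℝ, E) x'),
      (∀ w, (D w : E) = ((trivializationAt E (TangentSpace 𝓘(ℝ, E)) x₀).symmL ℝ x w : E)) →
      (ContinuousAlternatingMap.inCoordinates E ℝ x₀ x x₀ x (τ x)) v =
        (τ x').compContinuousLinearMap D v := by
    rintro x' rfl D hD
    simp only [ContinuousAlternatingMap.inCoordinates]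
    have : D = (trivializationAt E (TangentSpace 𝓘(ℝ, E)) x₀).symmL ℝ x' := by
      ext w; exact hD w
    rw [this]
    simp
  refine key _ h2 _ fun w => ?_
  rw [h1]
  rfl

theorem chartRep_transition {p : ℕ}
    (τ : ∀ x : M, TangentSpace 𝓘(ℝ, E) x [⋀^Fin p]→L[ℝ] ℝ) (x₀ x₁ : M) {y : E}
    (hy : y ∈ (extChartAt 𝓘(ℝ, E) x₀).target)
    (hy' : (extChartAt 𝓘(ℝ, E) x₀).symm y ∈ (extChartAt 𝓘(ℝ, E) x₁).source) :
    chartRep x₀ τ y = (chartRep x₁ τ (extChartAt 𝓘(ℝ, E) x₁ ((extChartAt 𝓘(ℝ, E) x₀).symm y))).compContinuousLinearMap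
      (fderiv ℝ (extChartAt 𝓘(ℝ, E) x₁ ∘ (extChartAt 𝓘(ℝ, E) x₀).symm) y) := by
  have hT : ContMDiffAt 𝓘(ℝ, E) 𝓘(ℝ, E) ∞ (extChartAt 𝓘(ℝ, E) x₁ ∘ (extChartAt 𝓘(ℝ, E) x₀).symm) y := by
    have h1 := contMDiffOn_extChartAt_symm (I := 𝓘(ℝ, E)) (n := ∞) x₀
    have h1 := h1.contMDiffAt ((isOpen_extChartAt_target (I := 𝓘(ℝ, E)) x₀).mem_nhds hy)
    exact (contMDiffAt_extChartAt' (by simpa using hy')).comp y h1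
  have hmd : MDifferentiableAt 𝓘(ℝ, E) 𝓘(ℝ, E)
      (extChartAt 𝓘(ℝ, E) x₁ ∘ (extChartAt 𝓘(ℝ, E) x₀).symm) y := hT.mdifferentiableAt (by simp)
  set T := extChartAt 𝓘(ℝ, E) x₁ ∘ (extChartAt 𝓘(ℝ, E) x₀).symm with hTdef
  have hTy : T y ∈ (extChartAt 𝓘(ℝ, E) x₁).target := (extChartAt 𝓘(ℝ, E) x₁).map_source hy'
  have hs : MDifferentiableAt 𝓘(ℝ, E) 𝓘(ℝ, E) (extChartAt 𝓘(ℝ, E) x₁).symm (T y) := by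
    have h1 := contMDiffOn_extChartAt_symm (I := 𝓘(ℝ, E)) (n := ∞) x₁
    exact (h1.contMDiffAt ((isOpen_extChartAt_target (I := 𝓘(ℝ, E)) x₁).mem_nhds hTy)).mdifferentiableAt
      (by simp)
  have heq : (extChartAt 𝓘(ℝ, E) x₀).symm =ᶠ[𝓝 y] (extChartAt 𝓘(ℝ, E) x₁).symm ∘ T := by
    have hc : ContinuousAt (extChartAt 𝓘(ℝ, E) x₀).symm y := continuousAt_extChartAt_symm'' hy
    have := hc.preimage_mem_nhds ((isOpen_extChartAt_source (I := 𝓘(ℝ, E)) x₁).mem_nhds hy')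
    filter_upwards [this] with z hz
    exact ((extChartAt 𝓘(ℝ, E) x₁).left_inv hz).symm
  have hD : mfderiv 𝓘(ℝ, E) 𝓘(ℝ, E) (extChartAt 𝓘(ℝ, E) x₀).symm y =
      mfderiv 𝓘(ℝ, E) 𝓘(ℝ, E) ((extChartAt 𝓘(ℝ, E) x₁).symm ∘ T) y := heq.mfderiv_eq
  rw [mfderiv_comp y hs hmd, mfderiv_eq_fderiv] at hD
  have hpt := heq.eq_of_nhds
  ext v
  have key : ∀ (a b : M) (h : a = b) (D : E →L[ℝ] TangentSpace 𝓘(ℝ, E) a)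
      (D' : E →L[ℝ] TangentSpace 𝓘(ℝ, E) b), (∀ w, (D w : E) = (D' w : E)) →
      (τ a).compContinuousLinearMap D v = (τ b).compContinuousLinearMap D' v := by
    rintro a b rfl D D' hDD
    have : D = D' := by ext w; exact hDD w
    rw [this]
  exact key _ _ hpt
    (mfderiv 𝓘(ℝ, E) 𝓘(ℝ, E) (extChartAt 𝓘(ℝ, E) x₀).symm y)
    (ContinuousLinearMap.comp (mfderiv 𝓘(ℝ, E) 𝓘(ℝ, E) (extChartAt 𝓘(ℝ, E) x₁).symm (T y))
      (fderiv ℝ T y)) (fun w => DFunLike.congr_fun hD w)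

theorem contDiffAt_transition (x₀ x₁ : M) {y : E}
    (hy : y ∈ (extChartAt 𝓘(ℝ, E) x₀).target)
    (hy' : (extChartAt 𝓘(ℝ, E) x₀).symm y ∈ (extChartAt 𝓘(ℝ, E) x₁).source) :
    ContDiffAt ℝ ∞ (extChartAt 𝓘(ℝ, E) x₁ ∘ (extChartAt 𝓘(ℝ, E) x₀).symm) y := by
  rw [← contMDiffAt_iff_contDiffAt]
  have h1 := contMDiffOn_extChartAt_symm (I := 𝓘(ℝ, E)) (n := ∞) x₀
  have h1 := h1.contMDiffAt ((isOpen_extChartAt_target (I := 𝓘(ℝ, E)) x₀).mem_nhds hy)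
  exact (contMDiffAt_extChartAt' (by simpa using hy')).comp y h1

theorem eventually_mem_source (x₀ x₁ : M) {y : E}
    (hy : y ∈ (extChartAt 𝓘(ℝ, E) x₀).target)
    (hy' : (extChartAt 𝓘(ℝ, E) x₀).symm y ∈ (extChartAt 𝓘(ℝ, E) x₁).source) :
    ∀ᶠ z in 𝓝 y, z ∈ (extChartAt 𝓘(ℝ, E) x₀).target ∧
      (extChartAt 𝓘(ℝ, E) x₀).symm z ∈ (extChartAt 𝓘(ℝ, E) x₁).source := by
  have hc : ContinuousAt (extChartAt 𝓘(ℝ, E) x₀).symm y := continuousAt_extChartAt_symm'' hy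
  have h1 := hc.preimage_mem_nhds ((isOpen_extChartAt_source (I := 𝓘(ℝ, E)) x₁).mem_nhds hy')
  filter_upwards [h1, (isOpen_extChartAt_target (I := 𝓘(ℝ, E)) x₀).mem_nhds hy] with z hz hz'
  exact ⟨hz', hz⟩

theorem contDiffAt_comp_fderiv {p : ℕ} {F : E → E [⋀^Fin p]→L[ℝ] ℝ} {T : E → E} {y : E}
    (hF : ContDiffAt ℝ ∞ F (T y)) (hT : ContDiffAt ℝ ∞ T y) :
    ContDiffAt ℝ ∞ (fun z => (F (T z)).compContinuousLinearMap (fderiv ℝ T z)) y := by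
  refine contDiffWithinAt_alternating (s := univ) fun w => ?_
  refine contDiffWithinAt_alternating_apply (f := fun z => F (T z))
    (u := fun i z => fderiv ℝ T z (w i)) (hF.comp y hT) fun i => ?_
  exact (hT.fderiv_right (m := ∞) (by simp)).clm_apply contDiffAt_const

theorem contMDiff_iff_chartRep {p : ℕ}
    (τ : ∀ x : M, TangentSpace 𝓘(ℝ, E) x [⋀^Fin p]→L[ℝ] Bundle.Trivial M ℝ x) :
    ContMDiff 𝓘(ℝ, E) (𝓘(ℝ, E).prod 𝓘(ℝ, E [⋀^Fin p]→L[ℝ] ℝ)) ∞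
      (fun x => Bundle.TotalSpace.mk' (E [⋀^Fin p]→L[ℝ] ℝ)
        (E := fun x : M => TangentSpace 𝓘(ℝ, E) x [⋀^Fin p]→L[ℝ] Bundle.Trivial M ℝ x)
        x (τ x)) ↔
      ∀ x₀ : M, ContDiffAt ℝ ∞ (chartRep x₀ τ) (extChartAt 𝓘(ℝ, E) x₀ x₀) := by
  refine forall_congr' fun x₀ => ?_
  rw [Bundle.contMDiffAt_section]
  have hsrc := extChartAt_source_mem_nhds (I := 𝓘(ℝ, E)) x₀
  have h1 : (fun x => (trivializationAt (E [⋀^Fin p]→L[ℝ] ℝ)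
      (fun x : M => TangentSpace 𝓘(ℝ, E) x [⋀^Fin p]→L[ℝ] Bundle.Trivial M ℝ x) x₀
        ⟨x, τ x⟩).2) =ᶠ[𝓝 x₀] (chartRep x₀ τ) ∘ extChartAt 𝓘(ℝ, E) x₀ := by
    filter_upwards [hsrc] with x hx
    exact trivialization_eq_chartRep x₀ τ hx
  rw [h1.contMDiffAt_iff]
  constructor
  · intro h
    rw [← contMDiffAt_iff_contDiffAt]
    have h2 := contMDiffOn_extChartAt_symm (I := 𝓘(ℝ, E)) (n := ∞) x₀
    have h2 := h2.contMDiffAt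
      ((isOpen_extChartAt_target (I := 𝓘(ℝ, E)) x₀).mem_nhds (mem_extChartAt_target x₀))
    have h3 : ContMDiffAt 𝓘(ℝ, E) 𝓘(ℝ, E [⋀^Fin p]→L[ℝ] ℝ) ∞
        (chartRep x₀ τ ∘ extChartAt 𝓘(ℝ, E) x₀)
        ((extChartAt 𝓘(ℝ, E) x₀).symm (extChartAt 𝓘(ℝ, E) x₀ x₀)) := by
      rwa [extChartAt_to_inv]
    refine (h3.comp _ h2).congr_of_eventuallyEq ?_
    filter_upwards [(isOpen_extChartAt_target (I := 𝓘(ℝ, E)) x₀).mem_nhds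
      (mem_extChartAt_target x₀)] with y hy
    simp only [Function.comp_apply]
    rw [(extChartAt 𝓘(ℝ, E) x₀).right_inv hy]
  · intro h
    exact h.contMDiffAt.comp x₀ contMDiffAt_extChartAt

theorem chartRep_extDerivAt_self {p : ℕ}
    (τ : ∀ x : M, TangentSpace 𝓘(ℝ, E) x [⋀^Fin p]→L[ℝ] ℝ) (x₁ : M) :
    chartRep x₁ (extDerivAt τ) (extChartAt 𝓘(ℝ, E) x₁ x₁) =
      extDeriv (chartRep x₁ τ) (extChartAt 𝓘(ℝ, E) x₁ x₁) := by
  have h1 := mfderiv_extChartAt_comp_mfderivWithin_extChartAt_symm (I := 𝓘(ℝ, E))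
    (mem_extChartAt_target x₁)
  rw [ModelWithCorners.Boundaryless.range_eq_univ, mfderivWithin_univ] at h1
  ext v
  have key : ∀ (a : M) (h : a = x₁) (D : E →L[ℝ] TangentSpace 𝓘(ℝ, E) a),
      (∀ w, (mfderiv 𝓘(ℝ, E) 𝓘(ℝ, E) (extChartAt 𝓘(ℝ, E) x₁) a (D w) : E) = w) →
      (extDerivAt τ a).compContinuousLinearMap D v =
        extDeriv (chartRep x₁ τ) (extChartAt 𝓘(ℝ, E) x₁ x₁) v := by
    rintro a rfl D hD
    simp only [extDerivAt]
    change extDeriv (chartRep a τ) (extChartAt 𝓘(ℝ, E) a a)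
      (fun i => mfderiv 𝓘(ℝ, E) 𝓘(ℝ, E) (extChartAt 𝓘(ℝ, E) a) a (D (v i))) = _
    congr 1
    funext i
    exact hD (v i)
  exact key _ (extChartAt_to_inv x₁)
    (mfderiv 𝓘(ℝ, E) 𝓘(ℝ, E) (extChartAt 𝓘(ℝ, E) x₁).symm (extChartAt 𝓘(ℝ, E) x₁ x₁))
    (fun w => DFunLike.congr_fun h1 w)

namespace Form

theorem contDiffAt_chartRep {p : ℕ} (τ : Form E M p) (x₀ : M) {y : E}
    (hy : y ∈ (extChartAt 𝓘(ℝ, E) x₀).target) : ContDiffAt ℝ ∞ (chartRep x₀ τ) y := by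
  set x₁ := (extChartAt 𝓘(ℝ, E) x₀).symm y with hx₁
  have hy' : (extChartAt 𝓘(ℝ, E) x₀).symm y ∈ (extChartAt 𝓘(ℝ, E) x₁).source :=
    mem_extChartAt_source x₁
  have hT := contDiffAt_transition x₀ x₁ hy hy'
  have h1 := (contMDiff_iff_chartRep τ).1 τ.contMDiff x₁
  refine (contDiffAt_comp_fderiv (T := extChartAt 𝓘(ℝ, E) x₁ ∘ (extChartAt 𝓘(ℝ, E) x₀).symm)
    h1 hT).congr_of_eventuallyEq ?_
  filter_upwards [eventually_mem_source x₀ x₁ hy hy'] with z hz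
  exact chartRep_transition τ x₀ x₁ hz.1 hz.2

theorem chartRep_extDerivAt {p : ℕ} (τ : Form E M p) (x₀ : M) {y : E}
    (hy : y ∈ (extChartAt 𝓘(ℝ, E) x₀).target) :
    chartRep x₀ (extDerivAt τ) y = extDeriv (chartRep x₀ τ) y := by
  set x₁ := (extChartAt 𝓘(ℝ, E) x₀).symm y with hx₁
  have hy' : (extChartAt 𝓘(ℝ, E) x₀).symm y ∈ (extChartAt 𝓘(ℝ, E) x₁).source :=
    mem_extChartAt_source x₁
  have hT := contDiffAt_transition x₀ x₁ hy hy'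
  have h1 := (contMDiff_iff_chartRep τ).1 τ.contMDiff x₁
  have heq : chartRep x₀ τ =ᶠ[𝓝 y] fun z =>
      (chartRep x₁ τ ((extChartAt 𝓘(ℝ, E) x₁ ∘ (extChartAt 𝓘(ℝ, E) x₀).symm) z)).compContinuousLinearMap
      (fderiv ℝ (extChartAt 𝓘(ℝ, E) x₁ ∘ (extChartAt 𝓘(ℝ, E) x₀).symm) z) := by
    filter_upwards [eventually_mem_source x₀ x₁ hy hy'] with z hz
    exact chartRep_transition τ x₀ x₁ hz.1 hz.2
  rw [heq.extDeriv_eq]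
  have hd : DifferentiableAt ℝ (chartRep x₁ τ)
      ((extChartAt 𝓘(ℝ, E) x₁ ∘ (extChartAt 𝓘(ℝ, E) x₀).symm) y) := h1.differentiableAt (by simp)
  refine Eq.trans ?_ (extDeriv_pullback hd hT (by
    rw [minSmoothness_of_isRCLikeNormedField]; exact WithTop.coe_le_coe.2 le_top)).symm
  rw [chartRep_transition _ x₀ x₁ hy hy', ← hx₁, chartRep_extDerivAt_self]
  rfl

theorem contMDiff_extDerivAt {p : ℕ} (τ : Form E M p) :
    ContMDiff 𝓘(ℝ, E) (𝓘(ℝ, E).prod 𝓘(ℝ, E [⋀^Fin (p + 1)]→L[ℝ] ℝ)) ∞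
      (fun x => Bundle.TotalSpace.mk' (E [⋀^Fin (p + 1)]→L[ℝ] ℝ)
        (E := fun x : M => TangentSpace 𝓘(ℝ, E) x [⋀^Fin (p + 1)]→L[ℝ] Bundle.Trivial M ℝ x)
        x (extDerivAt τ x)) := by
  rw [contMDiff_iff_chartRep]
  intro x₀
  have h := τ.contDiffAt_chartRep x₀ (mem_extChartAt_target x₀)
  have h2 : ContDiffAt ℝ ∞ (extDeriv (chartRep x₀ τ)) (extChartAt 𝓘(ℝ, E) x₀ x₀) := by
    let A : (E →L[ℝ] E [⋀^Fin p]→L[ℝ] ℝ) →L[ℝ] E [⋀^Fin (p + 1)]→L[ℝ] ℝ :=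
      ContinuousAlternatingMap.alternatizeUncurryFinCLM ℝ E ℝ
    have h3 : extDeriv (chartRep x₀ τ) = fun y => A (fderiv ℝ (chartRep x₀ τ) y) := rfl
    rw [h3]
    exact A.contDiff.contDiffAt.comp _ (h.fderiv_right (m := ∞) (by simp))
  refine h2.congr_of_eventuallyEq ?_
  filter_upwards [(isOpen_extChartAt_target (I := 𝓘(ℝ, E)) x₀).mem_nhds
      (mem_extChartAt_target x₀)] with y hy
  exact τ.chartRep_extDerivAt x₀ hy

/-- The exterior derivative `d : Ωᵖ(M) → Ωᵖ⁺¹(M)`. -/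
def d {p : ℕ} : Form E M p →ₗ[ℝ] Form E M (p + 1) where
  toFun τ := ⟨fun x => extDerivAt τ x, τ.contMDiff_extDerivAt⟩
  map_add' τ σ := by
    ext x : 1
    have h : chartRep x ⇑(τ + σ) = chartRep x τ + chartRep x σ := rfl
    have h1 := (τ.contDiffAt_chartRep x (mem_extChartAt_target x)).differentiableAt (by simp)
    have h2 := (σ.contDiffAt_chartRep x (mem_extChartAt_target x)).differentiableAt (by simp)
    change extDerivAt _ x = extDerivAt _ x + extDerivAt _ x
    simp only [extDerivAt]
    rw [h, extDeriv_add h1 h2]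
    rfl
  map_smul' c τ := by
    ext x : 1
    have h : chartRep x ⇑(c • τ) = c • chartRep x τ := rfl
    change extDerivAt _ x = c • extDerivAt _ x
    simp only [extDerivAt]
    rw [h, extDeriv_smul]
    rfl

end Form


variable (E M) in
/-- The space of all differential forms, `⨁ p, Ωᵖ(M)`; the product over `p` is the direct sum, as
`Ωᵖ(M) = 0` for `p > dim M`. -/
def Forms : Type _ := ∀ p : ℕ, Form E M p

namespace Forms

instance : AddCommGroup (Forms E M) := inferInstanceAs (AddCommGroup (∀ p : ℕ, Form E M p))

instance : Module ℝ (Forms E M) := inferInstanceAs (Module ℝ (∀ p : ℕ, Form E M p))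

/-- A `p`-form, as an element of the space of all forms. -/
def of {p : ℕ} (τ : Form E M p) : Forms E M := Pi.single p τ

@[simp]
theorem zero_apply (p : ℕ) : (0 : Forms E M) p = 0 := rfl

@[simp]
theorem add_apply (τ σ : Forms E M) (p : ℕ) : (τ + σ) p = τ p + σ p := rfl

@[simp]
theorem smul_apply (c : ℝ) (τ : Forms E M) (p : ℕ) : (c • τ) p = c • τ p := rfl

/-- The exterior derivative on the space of all forms; in particular its range consists of the
exact forms, and `0` is the only exact form of degree `0`. -/
def d : Forms E M →ₗ[ℝ] Forms E M where
  toFun τ := fun p => match p with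
    | 0 => 0
    | p + 1 => Form.d (τ p)
  map_add' τ σ := by
    funext p
    cases p with
    | zero => exact (add_zero 0).symm
    | succ p => exact map_add Form.d (τ p) (σ p)
  map_smul' c τ := by
    funext p
    cases p with
    | zero => exact (smul_zero (A := Form E M 0) c).symm
    | succ p => exact map_smul Form.d c (τ p)

end Forms

section Pointwise

variable {V : Type*} [AddCommGroup V] [Module ℝ V] [TopologicalSpace V] [IsTopologicalAddGroup V]
  [ContinuousSMul ℝ V] [T2Space V] [FiniteDimensional ℝ V]

theorem continuous_alternating {q : ℕ} (L : V [⋀^Fin q]→ₗ[ℝ] ℝ) : Continuous L := by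
  let b := Module.finBasis ℝ V
  have key : ∀ w, L w = ∑ σ : Fin q → Fin (Module.finrank ℝ V),
      (∏ i, b.coord (σ i) (w i)) * L (fun i => b (σ i)) := by
    intro w
    have h1 : w = fun i => ∑ j, b.coord j (w i) • b j := by
      funext i; exact (b.sum_repr _).symm
    conv_lhs => rw [h1]
    refine (L.toMultilinearMap.map_sum (fun i j => b.coord j (w i) • b j)).trans
      (Finset.sum_congr rfl fun σ _ => ?_)
    exact L.toMultilinearMap.map_smul_univ _ _
  have : (L : (Fin q → V) → ℝ) = _ := funext key
  rw [this]
  refine continuous_finsetSum _ fun σ _ => (continuous_finsetProd _ fun i _ => ?_).mul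
    continuous_const
  exact (b.coord (σ i)).continuous_of_finiteDimensional.comp (continuous_apply i)

/-- The pairing of the exterior algebra of `V` with a family of alternating forms on `V`, with
`⟨v₁ ∧ ⋯ ∧ v_p, τ⟩ = τ_p(v₁, …, v_p)`. -/
def pairing (τ : ∀ p, V [⋀^Fin p]→L[ℝ] ℝ) : ExteriorAlgebra ℝ V →ₗ[ℝ] ℝ :=
  ExteriorAlgebra.liftAlternating fun p => (τ p).toAlternatingMap

/-- The component of degree `q` of the contraction `X ⌟ τ` on a vector space `V`, namely
`w₁, …, w_q ↦ ⟨X ∧ w₁ ∧ ⋯ ∧ w_q, τ⟩`. -/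
def contractAt (X : ExteriorAlgebra ℝ V) (τ : ∀ p, V [⋀^Fin p]→L[ℝ] ℝ) (q : ℕ) :
    V [⋀^Fin q]→L[ℝ] ℝ :=
  let L : V [⋀^Fin q]→ₗ[ℝ] ℝ :=
    (pairing τ ∘ₗ LinearMap.mulLeft ℝ X).compAlternatingMap (ExteriorAlgebra.ιMulti ℝ q)
  { L with cont := continuous_alternating L }

theorem contractAt_apply (X : ExteriorAlgebra ℝ V) (τ : ∀ p, V [⋀^Fin p]→L[ℝ] ℝ) (q : ℕ)
    (w : Fin q → V) : contractAt X τ q w = pairing τ (X * ExteriorAlgebra.ιMulti ℝ q w) := rfl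

theorem contractAt_ιMulti {k : ℕ} (v : Fin k → V) (τ : ∀ p, V [⋀^Fin p]→L[ℝ] ℝ) (q : ℕ)
    (w : Fin q → V) :
    contractAt (ExteriorAlgebra.ιMulti ℝ k v) τ q w = τ (k + q) (Fin.append v w) := by
  rw [contractAt_apply, ExteriorAlgebra.ιMulti_mul_ιMulti, pairing,
    ExteriorAlgebra.liftAlternating_apply_ιMulti]
  rfl

theorem contractAt_add_left (X Y : ExteriorAlgebra ℝ V) (τ : ∀ p, V [⋀^Fin p]→L[ℝ] ℝ) (q : ℕ) :
    contractAt (X + Y) τ q = contractAt X τ q + contractAt Y τ q := by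
  ext w
  simp [contractAt_apply, add_mul]

theorem contractAt_smul_left (c : ℝ) (X : ExteriorAlgebra ℝ V) (τ : ∀ p, V [⋀^Fin p]→L[ℝ] ℝ)
    (q : ℕ) : contractAt (c • X) τ q = c • contractAt X τ q := by
  ext w
  simp [contractAt_apply]

theorem contractAt_add_right (X : ExteriorAlgebra ℝ V) (τ σ : ∀ p, V [⋀^Fin p]→L[ℝ] ℝ) (q : ℕ) :
    contractAt X (fun p => τ p + σ p) q = contractAt X τ q + contractAt X σ q := by
  ext w
  have : pairing (fun p => τ p + σ p) = pairing τ + pairing σ :=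
    map_add (ExteriorAlgebra.liftAlternating (R := ℝ) (M := V) (N := ℝ))
      (fun p => (τ p).toAlternatingMap) (fun p => (σ p).toAlternatingMap)
  simp [contractAt_apply, this]

theorem contractAt_smul_right (c : ℝ) (X : ExteriorAlgebra ℝ V) (τ : ∀ p, V [⋀^Fin p]→L[ℝ] ℝ)
    (q : ℕ) : contractAt X (fun p => c • τ p) q = c • contractAt X τ q := by
  ext w
  have : pairing (fun p => c • τ p) = c • pairing τ :=
    map_smul (ExteriorAlgebra.liftAlternating (R := ℝ) (M := V) (N := ℝ)) c
      (fun p => (τ p).toAlternatingMap)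
  simp [contractAt_apply, this]

end Pointwise

variable (E M) in
/-- Sections, not necessarily smooth or homogeneous, of the exterior bundle `Λ(TM)`. -/
def MVSection : Type _ := ∀ x : M, ExteriorAlgebra ℝ (TangentSpace 𝓘(ℝ, E) x)

instance : AddCommGroup (MVSection E M) :=
  inferInstanceAs (AddCommGroup (∀ x : M, ExteriorAlgebra ℝ (TangentSpace 𝓘(ℝ, E) x)))

instance : Module ℝ (MVSection E M) :=
  inferInstanceAs (Module ℝ (∀ x : M, ExteriorAlgebra ℝ (TangentSpace 𝓘(ℝ, E) x)))

@[simp]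
theorem MVSection.zero_apply (x : M) : (0 : MVSection E M) x = 0 := rfl

@[simp]
theorem MVSection.add_apply (X Y : MVSection E M) (x : M) : (X + Y) x = X x + Y x := rfl

@[simp]
theorem MVSection.smul_apply (c : ℝ) (X : MVSection E M) (x : M) : (c • X) x = c • X x := rfl

/-- The multivector field `V₁ ∧ ⋯ ∧ V_k`. -/
def wedge {k : ℕ} (V : Fin k → VecField E M) : MVSection E M :=
  fun x => ExteriorAlgebra.ιMulti ℝ k fun i => V i x

variable (E M) in
/-- The smooth `(j+1)`-vector fields on `M`, that is, the smooth sections of `Λʲ⁺¹(TM)`: locally they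
are finite sums of wedges of `j + 1` smooth vector fields. Here `j` is the degree of the field in
the graded Lie algebra of multivector fields. -/
def MultiVec (j : ℕ) : Submodule ℝ (MVSection E M) where
  carrier := {X | ∀ x₀ : M, ∃ l : List (Fin (j + 1) → VecField E M),
    ∀ᶠ x in 𝓝 x₀, X x = (l.map fun V => wedge V x).sum}
  zero_mem' := fun _ => ⟨[], by simp⟩
  add_mem' := by
    intro X Y hX hY x₀
    obtain ⟨l, hl⟩ := hX x₀
    obtain ⟨m, hm⟩ := hY x₀
    refine ⟨l ++ m, ?_⟩
    filter_upwards [hl, hm] with x h1 h2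
    simp [h1, h2]
  smul_mem' := by
    intro c X hX x₀
    obtain ⟨l, hl⟩ := hX x₀
    refine ⟨l.map fun V => Function.update V 0 (c • V 0), ?_⟩
    filter_upwards [hl] with x h1
    have h2 : ∀ V : Fin (j + 1) → VecField E M,
        wedge (Function.update V 0 (c • V 0)) x = c • wedge V x := by
      intro V
      have h3 : (fun i => (Function.update V 0 (c • V 0) : Fin (j + 1) → VecField E M) i x) =
          Function.update (fun i => V i x) 0 (c • V 0 x) := by
        funext i
        by_cases hi : i = 0
        · subst hi; simp
        · simp [hi]
      rw [wedge, h3, AlternatingMap.map_update_smul, wedge, Function.update_eq_self]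
    rw [MVSection.smul_apply, h1, List.smul_sum, List.map_map, List.map_map]
    congr 1
    exact List.map_congr_left fun V _ => (h2 V).symm

instance (x : M) : FiniteDimensional ℝ (TangentSpace 𝓘(ℝ, E) x) :=
  inferInstanceAs (FiniteDimensional ℝ E)

instance (x : M) : T2Space (TangentSpace 𝓘(ℝ, E) x) := inferInstanceAs (T2Space E)

/-- The Schouten bracket of decomposable multivector fields,
`∑ (-1)^(a+b) [V_a, W_b] ∧ V₁ ∧ ⋯ V̂_a ⋯ ∧ V_k ∧ W₁ ∧ ⋯ Ŵ_b ⋯ ∧ W_l`. -/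
def schoutenWedge {i j : ℕ} (V : Fin (i + 1) → VecField E M) (W : Fin (j + 1) → VecField E M) :
    MVSection E M := fun x =>
  ∑ a : Fin (i + 1), ∑ b : Fin (j + 1), (-1 : ℝ) ^ (a + b : ℕ) •
    (ExteriorAlgebra.ι ℝ (VectorField.mlieBracket 𝓘(ℝ, E) (V a) (W b) x) *
      wedge (fun s => V (a.succAbove s)) x * wedge (fun s => W (b.succAbove s)) x)

/-- The Schouten bracket `[X, Y]` of multivector fields, of multivector degrees `i + 1`, `j + 1` and
`i + j + 1`: it is given by `schoutenWedge` on wedges of vector fields and is extended by linearity.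
This is required pointwise, for all ways of writing `X` and `Y` near a point as sums of wedges. -/
def IsSchoutenBracket
    (br : ∀ i j : ℕ, MultiVec E M i →ₗ[ℝ] MultiVec E M j →ₗ[ℝ] MultiVec E M (i + j)) : Prop :=
  ∀ (i j : ℕ) (X : MultiVec E M i) (Y : MultiVec E M j) (x₀ : M)
    (l : List (Fin (i + 1) → VecField E M)) (m : List (Fin (j + 1) → VecField E M)),
    (∀ᶠ x in 𝓝 x₀, X.1 x = (l.map fun V => wedge V x).sum) →
    (∀ᶠ x in 𝓝 x₀, Y.1 x = (m.map fun W => wedge W x).sum) →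
    (br i j X Y).1 x₀ = (l.map fun V => (m.map fun W => schoutenWedge V W x₀).sum).sum

theorem contMDiff_contract {j q : ℕ} (X : MultiVec E M j) (τ : Forms E M) :
    ContMDiff 𝓘(ℝ, E) (𝓘(ℝ, E).prod 𝓘(ℝ, E [⋀^Fin q]→L[ℝ] ℝ)) ∞
      (fun x => Bundle.TotalSpace.mk' (E [⋀^Fin q]→L[ℝ] ℝ)
        (E := fun x : M => TangentSpace 𝓘(ℝ, E) x [⋀^Fin q]→L[ℝ] Bundle.Trivial M ℝ x)
        x (contractAt (X.1 x) (fun p => τ p x) q)) := by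
  rw [contMDiff_iff_chartRep]
  intro x₀
  obtain ⟨l, hl⟩ := X.2 x₀
  set y₀ := extChartAt 𝓘(ℝ, E) x₀ x₀ with hy₀
  have htgt := (isOpen_extChartAt_target (I := 𝓘(ℝ, E)) x₀).mem_nhds (mem_extChartAt_target x₀)
  obtain ⟨P, hP, hD⟩ : ∃ P : VecField E M → E → E, (∀ V, ContDiffAt ℝ ∞ (P V) y₀) ∧
      ∀ V, ∀ y ∈ (extChartAt 𝓘(ℝ, E) x₀).target,
        mfderiv 𝓘(ℝ, E) 𝓘(ℝ, E) (extChartAt 𝓘(ℝ, E) x₀).symm y (P V y) =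
          V ((extChartAt 𝓘(ℝ, E) x₀).symm y) := by
    refine ⟨fun V y => VectorField.mpullback 𝓘(ℝ, E) 𝓘(ℝ, E) (extChartAt 𝓘(ℝ, E) x₀).symm V y,
      fun V => ?_, fun V y hy => ?_⟩
    · have h1 := VectorField.contMDiffWithinAt_mpullbackWithin_extChartAt_symm (m := ∞) (n := ∞)
        (s := univ) (V.contMDiff.contMDiffAt (x := x₀)).contMDiffWithinAt uniqueMDiffOn_univ
        (mem_univ _) (by simp)
      simp only [preimage_univ, inter_univ, ModelWithCorners.Boundaryless.range_eq_univ,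
        VectorField.mpullbackWithin_univ] at h1
      have h2 := h1.contMDiffAt htgt
      rw [← contMDiffWithinAt_univ, contMDiffWithinAt_vectorSpace_iff_contDiffWithinAt] at h2
      exact h2
    · have hinv := isInvertible_mfderivWithin_extChartAt_symm (I := 𝓘(ℝ, E)) hy
      rw [ModelWithCorners.Boundaryless.range_eq_univ, mfderivWithin_univ] at hinv
      change mfderiv 𝓘(ℝ, E) 𝓘(ℝ, E) (extChartAt 𝓘(ℝ, E) x₀).symm y
        (VectorField.mpullback 𝓘(ℝ, E) 𝓘(ℝ, E) (extChartAt 𝓘(ℝ, E) x₀).symm V y) = _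
      rw [VectorField.mpullback_apply]
      exact hinv.self_apply_inverse _
  refine contDiffWithinAt_alternating (s := univ) fun w => ?_
  have hc : Tendsto (extChartAt 𝓘(ℝ, E) x₀).symm (𝓝 y₀) (𝓝 x₀) := by
    have := continuousAt_extChartAt_symm (I := 𝓘(ℝ, E)) x₀
    rwa [ContinuousAt, extChartAt_to_inv] at this
  have heq : (fun y => chartRep x₀ (fun x => contractAt (X.1 x) (fun p => τ p x) q) y w) =ᶠ[𝓝 y₀]
      fun y => (l.map fun V => chartRep x₀ (τ (j + 1 + q)) y
        (Fin.append (fun i => P (V i) y) w)).sum := by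
    filter_upwards [hc.eventually hl, htgt] with y hy hyt
    change pairing (fun p => τ p ((extChartAt 𝓘(ℝ, E) x₀).symm y))
      (X.1 ((extChartAt 𝓘(ℝ, E) x₀).symm y) * ExteriorAlgebra.ιMulti ℝ q
        (fun i => mfderiv 𝓘(ℝ, E) 𝓘(ℝ, E) (extChartAt 𝓘(ℝ, E) x₀).symm y (w i))) = _
    rw [hy, ← List.sum_map_mul_right, map_list_sum, List.map_map]
    congr 1
    refine List.map_congr_left fun V _ => ?_
    refine (contractAt_ιMulti (fun i => V i ((extChartAt 𝓘(ℝ, E) x₀).symm y))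
      (fun p => τ p ((extChartAt 𝓘(ℝ, E) x₀).symm y)) q _).trans ?_
    change _ = τ (j + 1 + q) ((extChartAt 𝓘(ℝ, E) x₀).symm y) (fun i =>
      mfderiv 𝓘(ℝ, E) 𝓘(ℝ, E) (extChartAt 𝓘(ℝ, E) x₀).symm y
        (Fin.append (fun i => P (V i) y) w i))
    congr 1
    funext i
    refine Fin.addCases (fun i => ?_) (fun i => ?_) i
    · rw [Fin.append_left]
      exact (hD (V i) y hyt).symm.trans (congrArg
        (mfderiv 𝓘(ℝ, E) 𝓘(ℝ, E) (extChartAt 𝓘(ℝ, E) x₀).symm y)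
        (Fin.append_left (α := E) (fun i => P (V i) y) w i).symm)
    · rw [Fin.append_right]
      exact congrArg (mfderiv 𝓘(ℝ, E) 𝓘(ℝ, E) (extChartAt 𝓘(ℝ, E) x₀).symm y)
        (Fin.append_right (α := E) (fun i => P (V i) y) w i).symm
  have hsum : ∀ l : List (Fin (j + 1) → VecField E M), ContDiffAt ℝ ∞ (fun y =>
      (l.map fun V => chartRep x₀ (τ (j + 1 + q)) y
        (Fin.append (fun i => P (V i) y) w)).sum) y₀ := by
    intro l
    induction l with
    | nil => simpa using contDiffAt_const
    | cons V l ih =>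
      simp only [List.map_cons, List.sum_cons]
      refine ContDiffAt.add ?_ ih
      refine contDiffWithinAt_alternating_apply (s := univ)
        (u := fun i y => Fin.append (fun i => P (V i) y) w i)
        ((τ (j + 1 + q)).contDiffAt_chartRep x₀ (mem_extChartAt_target x₀)) fun i => ?_
      refine Fin.addCases (fun i => ?_) (fun i => ?_) i
      · simp only [Fin.append_left]
        exact hP (V i)
      · simp only [Fin.append_right]
        exact contDiffWithinAt_const
  exact (hsum l).congr_of_eventuallyEq heq

/-- The contraction `X ⌟ τ`, with `(X₁ ∧ ⋯ ∧ X_k) ⌟ τ = X_k ⌟ ⋯ ⌟ X₁ ⌟ τ = τ(X₁, …, X_k, ·, …, ·)`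
(see `contractAt_ιMulti`). -/
def contract {j : ℕ} : MultiVec E M j →ₗ[ℝ] Forms E M →ₗ[ℝ] Forms E M :=
  LinearMap.mk₂ ℝ
    (fun X τ q => ⟨fun x => contractAt (X.1 x) (fun p => τ p x) q, contMDiff_contract X τ⟩)
    (fun X Y τ => by
      funext q
      ext x : 1
      exact contractAt_add_left (X.1 x) (Y.1 x) (fun p => τ p x) q)
    (fun c X τ => by
      funext q
      ext x : 1
      exact contractAt_smul_left c (X.1 x) (fun p => τ p x) q)
    (fun X τ σ => by
      funext q
      ext x : 1
      exact contractAt_add_right (X.1 x) (fun p => τ p x) (fun p => σ p x) q)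
    (fun c X τ => by
      funext q
      ext x : 1
      exact contractAt_smul_right c (X.1 x) (fun p => τ p x) q)

/-- The Lie derivative along a `k`-vector field, `k = j + 1`:
`L_X τ = d(X ⌟ τ) - (-1)ᵏ X ⌟ dτ`. -/
def lieDeriv {j : ℕ} : MultiVec E M j →ₗ[ℝ] Forms E M →ₗ[ℝ] Forms E M :=
  contract.compr₂ Forms.d - (-1 : ℝ) ^ (j + 1) • contract.compl₂ Forms.d

theorem lieDeriv_apply {j : ℕ} (X : MultiVec E M j) (τ : Forms E M) :
    lieDeriv X τ = Forms.d (contract X τ) - (-1 : ℝ) ^ (j + 1) • contract X (Forms.d τ) := rfl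

/-- A graded Lie bracket of degree `0` on the graded vector space `⨁ i, L i`: the bracket is graded
skew-symmetric and satisfies the graded Jacobi identity. -/
def IsGradedLieBracket {L : ℕ → Type*} [∀ i, AddCommGroup (L i)] [∀ i, Module ℝ (L i)]
    (br : ∀ i j : ℕ, L i →ₗ[ℝ] L j →ₗ[ℝ] L (i + j)) : Prop :=
  (∀ (i j : ℕ) (x : L i) (y : L j),
    DirectSum.of L (i + j) (br i j x y) =
      -((-1 : ℝ) ^ (i * j) • DirectSum.of L (j + i) (br j i y x))) ∧
  ∀ (i j k : ℕ) (x : L i) (y : L j) (z : L k),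
    (-1 : ℝ) ^ (i * k) • DirectSum.of L (i + (j + k)) (br i (j + k) x (br j k y z)) +
    (-1 : ℝ) ^ (j * i) • DirectSum.of L (j + (k + i)) (br j (k + i) y (br k i z x)) +
    (-1 : ℝ) ^ (k * j) • DirectSum.of L (k + (i + j)) (br k (i + j) z (br i j x y)) = 0

/-- The three kinds of conserved quantities and of continuous symmetries. -/
inductive Kind
  | loc
  | glob
  | str

/-- The closed forms, the exact forms, and the zero form, respectively. -/
def Kind.forms : Kind → Submodule ℝ (Forms E M)
  | Kind.loc => LinearMap.ker Forms.d
  | Kind.glob => LinearMap.range Forms.d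
  | Kind.str => ⊥

variable (E M) in
/-- A multi-Hamiltonian system `(M, ω, H)`: an `n`-plectic form `ω` on `M` (a closed `(n+1)`-form
such that `v ↦ v ⌟ ω` is injective on tangent vectors), a Hamiltonian `(n-1)`-form `H`, and the
vector field `X_H` with `dH = -X_H ⌟ ω`. -/
structure MultiHamiltonianSystem (n : ℕ) where
  form : Form E M (n + 1)
  closed : Form.d form = 0
  nondegenerate : ∀ (x : M) (v : TangentSpace 𝓘(ℝ, E) x),
    (∀ w : Fin n → TangentSpace 𝓘(ℝ, E) x, form x (Fin.cons v w) = 0) → v = 0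
  H : Form E M (n - 1)
  XH : MultiVec E M 0
  hamiltonian : Forms.d (Forms.of H) = -contract XH (Forms.of form)

namespace MultiHamiltonianSystem

variable {n : ℕ} (sys : MultiHamiltonianSystem E M n)

/-- The form `ω`, as an element of the space of all forms. -/
def plecticForm : Forms E M := Forms.of sys.form

/-- The form `H`, as an element of the space of all forms. -/
def hamiltonianForm : Forms E M := Forms.of sys.H

/-- `X` is a Hamiltonian multivector field of the form `α`: `dα = -X ⌟ ω`. -/
def IsHamiltonianField {j : ℕ} (α : Forms E M) (X : MultiVec E M j) : Prop :=
  Forms.d α = -contract X sys.plecticForm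

/-- The Poisson bracket `{α, β} = (-1)^(l+1) X_β ⌟ X_α ⌟ ω` of two Hamiltonian forms, expressed
through their Hamiltonian multivector fields; `l = j + 1` is the degree of `X_β`. -/
def poissonBracket {i j : ℕ} (Xα : MultiVec E M i) (Xβ : MultiVec E M j) : Forms E M :=
  (-1 : ℝ) ^ (j + 1 + 1) • contract Xβ (contract Xα sys.plecticForm)

/-- The Hamiltonian `(j+1)`-vector fields: `X ⌟ ω` is exact. -/
def hamiltonianFields (j : ℕ) : Submodule ℝ (MultiVec E M j) where
  carrier := {X | contract X sys.plecticForm ∈ LinearMap.range (Forms.d (E := E) (M := M))}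
  zero_mem' := by
    rw [mem_ofPred_eq, map_zero, LinearMap.zero_apply]
    exact zero_mem _
  add_mem' hX hY := by
    simp only [mem_ofPred_eq, map_add, LinearMap.add_apply] at *
    exact add_mem hX hY
  smul_mem' c X hX := by
    simp only [mem_ofPred_eq, map_smul, LinearMap.smul_apply] at *
    exact Submodule.smul_mem _ c hX

/-- The continuous symmetries of degree `j + 1`: the Hamiltonian multivector fields `X` for which
`L_X H` is closed, exact or zero. -/
def symmetries (t : Kind) (j : ℕ) : Submodule ℝ (MultiVec E M j) where
  carrier := {X | X ∈ sys.hamiltonianFields j ∧ lieDeriv X sys.hamiltonianForm ∈ t.forms}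
  zero_mem' := by simp
  add_mem' hX hY := by
    simp only [mem_ofPred_eq, map_add, LinearMap.add_apply] at *
    exact ⟨add_mem hX.1 hY.1, add_mem hX.2 hY.2⟩
  smul_mem' c X hX := by
    simp only [mem_ofPred_eq, map_smul, LinearMap.smul_apply] at *
    exact ⟨Submodule.smul_mem _ c hX.1, Submodule.smul_mem _ c hX.2⟩

/-- The conserved quantities of degree `n - k`, `k = j + 1` (there are no nonzero ones if `k > n`):
the Hamiltonian `(n-k)`-forms `α` for which `L_{X_H} α` is closed, exact or zero. -/
def conserved (t : Kind) (j : ℕ) : Submodule ℝ (Forms E M) where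
  carrier := {α | (∀ p, p + (j + 1) ≠ n → α p = 0) ∧
    (∃ X : MultiVec E M j, sys.IsHamiltonianField α X) ∧ lieDeriv sys.XH α ∈ t.forms}
  zero_mem' := ⟨fun _ _ => rfl, ⟨0, by simp [IsHamiltonianField]⟩, by simp⟩
  add_mem' := by
    rintro α β ⟨h1, ⟨X, hX⟩, h2⟩ ⟨h3, ⟨Y, hY⟩, h4⟩
    refine ⟨fun p hp => ?_, ⟨X + Y, ?_⟩, ?_⟩
    · rw [Forms.add_apply, h1 p hp, h3 p hp, add_zero]
    · simp only [IsHamiltonianField, map_add, LinearMap.add_apply, neg_add] at *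
      rw [hX, hY]
    · rw [map_add]
      exact add_mem h2 h4
  smul_mem' := by
    rintro c α ⟨h1, ⟨X, hX⟩, h2⟩
    refine ⟨fun p hp => ?_, ⟨c • X, ?_⟩, ?_⟩
    · rw [Forms.smul_apply, h1 p hp]
      exact smul_zero (A := Form E M p) c
    · simp only [IsHamiltonianField, map_smul, LinearMap.smul_apply] at *
      rw [hX, smul_neg]
    · rw [map_smul]
      exact Submodule.smul_mem _ c h2

/-- The kernel of `ω` in degree `j + 1`: the multivector fields `κ` with `κ ⌟ ω = 0`. -/
def kernel (j : ℕ) : Submodule ℝ (MultiVec E M j) :=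
  LinearMap.ker (contract.flip sys.plecticForm)

/-- The conserved quantities modulo the closed forms. -/
def ConservedQuot (t : Kind) (j : ℕ) : Type _ :=
  sys.conserved t j ⧸ (LinearMap.ker Forms.d).submoduleOf (sys.conserved t j)

instance (t : Kind) (j : ℕ) : AddCommGroup (sys.ConservedQuot t j) :=
  inferInstanceAs
    (AddCommGroup (sys.conserved t j ⧸ (LinearMap.ker Forms.d).submoduleOf (sys.conserved t j)))

instance (t : Kind) (j : ℕ) : Module ℝ (sys.ConservedQuot t j) :=
  inferInstanceAs
    (Module ℝ (sys.conserved t j ⧸ (LinearMap.ker Forms.d).submoduleOf (sys.conserved t j)))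

/-- The class of a conserved quantity modulo the closed forms. -/
def conservedClass (t : Kind) (j : ℕ) : sys.conserved t j →ₗ[ℝ] sys.ConservedQuot t j :=
  Submodule.mkQ _

/-- The continuous symmetries modulo the kernel of `ω`. -/
def SymmetryQuot (t : Kind) (j : ℕ) : Type _ :=
  sys.symmetries t j ⧸ (sys.kernel j).submoduleOf (sys.symmetries t j)

instance (t : Kind) (j : ℕ) : AddCommGroup (sys.SymmetryQuot t j) :=
  inferInstanceAs
    (AddCommGroup (sys.symmetries t j ⧸ (sys.kernel j).submoduleOf (sys.symmetries t j)))

instance (t : Kind) (j : ℕ) : Module ℝ (sys.SymmetryQuot t j) :=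
  inferInstanceAs
    (Module ℝ (sys.symmetries t j ⧸ (sys.kernel j).submoduleOf (sys.symmetries t j)))

/-- The class of a continuous symmetry modulo the kernel of `ω`. -/
def symmetryClass (t : Kind) (j : ℕ) : sys.symmetries t j →ₗ[ℝ] sys.SymmetryQuot t j :=
  Submodule.mkQ _

end MultiHamiltonianSystem

end Multisymplectic

end

open Multisymplectic

/-! Write `i_X` for contraction by `X` and `L_X` for the graded commutator of `d` with `i_X`. The
theorem is proved with operators on the space of forms. On a Hausdorff manifold smooth forms take
all values at a point, so `X ↦ i_X` is injective (`contract_injective`), and identities between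
multivector fields may be checked on contractions. For `X`, `Y` in degrees `i`, `j` the Schouten
bracket is characterised by `i_[X,Y] = (-1)^(i(j+1)) L_X i_Y - i_Y L_X`. This follows algebraically
(`sum_sum_revProd_succAbove`) from `[L_V, i_W] = i_[V,W]` for vector fields
(`gradedLie_insert_commutator`). The right side mentions no decomposition into wedges, so the
bracket is well defined and smooth (`exists_contract_eq_bracketOp`). Skew-symmetry and Jacobi then
use only that `d² = 0` and that contractions commute up to sign (`derivedBracket_skew`,
`derivedBracket_jacobi`).

The same algebra gives `L_[X,Y] = (-1)^(ij) L_X L_Y - L_Y L_X`. As `L_X` preserves closed, exact and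
zero forms, symmetries of each kind are closed under the bracket. For Hamiltonian `X`, `Y` the
formula collapses to `i_[X,Y] ω = ± d(i_Y i_X ω)` (`contract_schouten_plecticForm`). Hence the
bracket descends modulo the kernel of `ω`, and `[X_α, X_β]` is a Hamiltonian field of `{α, β}`.

Conserved quantities and symmetries are linked by `L_{X_H} α + L_{X_α} H = d(i_{X_H} α + i_{X_α} H)`
(`lieDeriv_add_lieDeriv_mem`): modulo exact forms one condition is the other. Since `X_α ⌟ ω = -dα`,
the class of `X_α` is determined by `α` and is zero exactly when `α` is closed. The bracket on
conserved classes is obtained by transport from symmetries, so its Lie identities need no separate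
proof. -/

namespace Multisymplectic

noncomputable section

/-! ### Graded commutators and derived brackets in an associative algebra -/

section GradedOperators

variable {R : Type*} [Ring R] [Algebra ℝ R]

/-- The product of a family of ring elements in reverse order, `v_{k-1} * ⋯ * v_0`. -/
def revProd : {k : ℕ} → (Fin k → R) → R
  | 0, _ => 1
  | _ + 1, v => revProd (fun i => v i.succ) * v 0

@[simp]
theorem revProd_zero (v : Fin 0 → R) : revProd v = 1 := rfl

theorem revProd_succ {k : ℕ} (v : Fin (k + 1) → R) :
    revProd v = revProd (fun i => v i.succ) * v 0 := rfl

theorem revProd_mul_of_anticomm {k : ℕ} (v : Fin k → R) (x : R) (h : ∀ i, v i * x = -(x * v i)) :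
    revProd v * x = (-1 : ℝ) ^ k • (x * revProd v) := by
  induction k with
  | zero => simp
  | succ k ih =>
    rw [revProd_succ, mul_assoc, h, mul_neg, ← mul_assoc, ih _ fun i => h i.succ, pow_succ]
    simp [mul_assoc]

theorem revProd_mul_revProd {k l : ℕ} (v : Fin k → R) (w : Fin l → R)
    (h : ∀ i j, v i * w j = -(w j * v i)) :
    revProd v * revProd w = (-1 : ℝ) ^ (k * l) • (revProd w * revProd v) := by
  induction l with
  | zero => simp
  | succ l ih =>
    rw [revProd_succ w, ← mul_assoc, ih _ fun i j => h i j.succ, smul_mul_assoc, mul_assoc,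
      revProd_mul_of_anticomm v (w 0) fun i => h i 0, mul_smul_comm, smul_smul, mul_assoc, mul_add,
      pow_add, mul_one]

/-- The graded commutator of `d` with an operator `x` of degree `-k`. -/
def gradedLie (d : R) (k : ℕ) (x : R) : R := d * x - (-1 : ℝ) ^ k • (x * d)

/-- The graded Leibniz rule with `y` in degree `-1`: the case needed to split the rightmost factor
off `revProd`. -/
theorem gradedLie_mul (d x y : R) (k : ℕ) :
    gradedLie d (k + 1) (x * y) =
      gradedLie d k x * y + (-1 : ℝ) ^ k • (x * gradedLie d 1 y) := by
  rcases neg_one_pow_eq_or ℝ k with hk | hk <;>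
    simp only [gradedLie, pow_succ, hk, pow_zero, mul_neg, mul_one, neg_neg, neg_smul,
      one_smul] <;> noncomm_ring

/-- Commutation with `L` is a derivation, so it replaces each factor `v t` in turn by `c t`. Moving
`c t` to the right end past the `t` factors `v (t-1), …, v 0` produces the sign. -/
theorem commutator_revProd {l : ℕ} (L : R) (v c : Fin (l + 1) → R)
    (hL : ∀ t, L * v t - v t * L = c t) (hc : ∀ s t, v s * c t = -(c t * v s)) :
    L * revProd v - revProd v * L =
      ∑ t : Fin (l + 1), (-1 : ℝ) ^ (t : ℕ) • (revProd (fun s => v (t.succAbove s)) * c t) := by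
  induction l with
  | zero => simp [revProd_succ, hL]
  | succ l ih =>
    have h1 := ih (fun t => v t.succ) (fun t => c t.succ) (fun t => hL t.succ)
      fun s t => hc s.succ t.succ
    have h2 : L * revProd v - revProd v * L = revProd (fun t => v t.succ) * (L * v 0 - v 0 * L) +
        (L * revProd (fun t => v t.succ) - revProd (fun t => v t.succ) * L) * v 0 := by
      rw [revProd_succ]
      noncomm_ring
    rw [h2, h1, hL, Fin.sum_univ_succ (n := l + 1), Finset.sum_mul]
    congr 1
    · simp
    · refine Finset.sum_congr rfl fun t _ => ?_
      rw [revProd_succ (fun s => v (t.succ.succAbove s))]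
      simp only [Fin.succ_succAbove_succ, Fin.succ_succAbove_zero, Fin.val_succ]
      rw [mul_assoc (revProd _), hc, smul_mul_assoc, mul_neg, pow_succ, mul_neg_one, neg_smul,
        smul_neg, neg_neg, mul_assoc]

/-- The Cartan formula `i_[X,Y] = (-1)^((k-1)l) L_X i_Y - i_Y L_X` for decomposable multivector
fields, deduced from the one for vector fields. -/
theorem sum_sum_revProd_succAbove {k l : ℕ} (d : R) (v : Fin (k + 1) → R) (w : Fin (l + 1) → R)
    (c : Fin (k + 1) → Fin (l + 1) → R) (hvw : ∀ s t, v s * w t = -(w t * v s))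
    (hd : ∀ s t, gradedLie d 1 (v s) * w t - w t * gradedLie d 1 (v s) = c s t)
    (hv : ∀ r s t, v r * c s t = -(c s t * v r)) (hw : ∀ r s t, w r * c s t = -(c s t * w r)) :
    ∑ s : Fin (k + 1), ∑ t : Fin (l + 1), (-1 : ℝ) ^ (s + t : ℕ) •
        (revProd (fun r => w (t.succAbove r)) * (revProd (fun r => v (s.succAbove r)) * c s t)) =
      (-1 : ℝ) ^ (k * (l + 1)) • (gradedLie d (k + 1) (revProd v) * revProd w) -
        revProd w * gradedLie d (k + 1) (revProd v) := by
  induction k with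
  | zero =>
    have h := commutator_revProd (gradedLie d 1 (v 0)) w (c 0) (hd 0) fun s t => hw s 0 t
    simpa [revProd_succ] using h.symm
  | succ k ih =>
    -- Here `revProd v = A * v 0`, and the Leibniz rule splits its graded commutator with `d` into a
    -- part with `L * v 0` and a part with `A` times that of `v 0`. These correspond to the terms `s
    -- > 0` and `s = 0` of the sum.
    set A := revProd fun s => v s.succ with hA
    set B := revProd w with hB
    set L := gradedLie d (k + 1) A with hL
    have h1 := ih (fun s => v s.succ) (fun s => c s.succ) (fun s t => hvw s.succ t)
      (fun s t => hd s.succ t) (fun r s t => hv r.succ s.succ t) (fun r s t => hw r s.succ t)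
    have h2 := commutator_revProd (gradedLie d 1 (v 0)) w (c 0) (hd 0) fun s t => hw s 0 t
    have h3 : v 0 * B = (-1 : ℝ) ^ (l + 1) • (B * v 0) := by
      have := revProd_mul_of_anticomm w (v 0) fun t => by rw [hvw, neg_neg]
      rw [hB, this, smul_smul, ← mul_pow]
      simp
    have h4 : B * A = (-1 : ℝ) ^ ((l + 1) * (k + 1)) • (A * B) :=
      revProd_mul_revProd w _ fun t s => by rw [hvw, neg_neg]
    have h5 : ∀ t : Fin (l + 1), revProd (fun r => w (t.succAbove r)) * A =
        (-1 : ℝ) ^ (l * (k + 1)) • (A * revProd (fun r => w (t.succAbove r))) := fun t =>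
      revProd_mul_revProd _ _ fun t s => by rw [hvw, neg_neg]
    -- The terms `s = 0`. The sign comes from moving the `k + 1` factors of `A` across the `l`
    -- remaining factors of `B`.
    have e1 : ∑ t : Fin (l + 1), (-1 : ℝ) ^ (t : ℕ) •
        (revProd (fun r => w (t.succAbove r)) * (A * c 0 t)) =
        (-1 : ℝ) ^ (l * (k + 1)) • (A * (gradedLie d 1 (v 0) * B - B * gradedLie d 1 (v 0))) := by
      rw [h2, Finset.mul_sum, Finset.smul_sum]
      refine Finset.sum_congr rfl fun t _ => ?_
      rw [← mul_assoc, h5, smul_mul_assoc, smul_smul, mul_smul_comm, smul_smul, mul_comm, mul_assoc]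
    -- The terms `s > 0`. Moving `v 0` to the right past `c s.succ t` gives the one sign by which
    -- `s.succ` differs from `s`, so the induction hypothesis applies.
    have e2 : ∑ s : Fin (k + 1), ∑ t : Fin (l + 1), (-1 : ℝ) ^ ((s.succ : ℕ) + t : ℕ) •
        (revProd (fun r => w (t.succAbove r)) *
          (revProd (fun r => v (s.succ.succAbove r)) * c s.succ t)) =
        ((-1 : ℝ) ^ (k * (l + 1)) • (L * B) - B * L) * v 0 := by
      rw [← h1, Finset.sum_mul]
      refine Finset.sum_congr rfl fun s _ => ?_
      rw [Finset.sum_mul]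
      refine Finset.sum_congr rfl fun t _ => ?_
      rw [revProd_succ (fun r => v (s.succ.succAbove r))]
      simp only [Fin.succ_succAbove_succ, Fin.succ_succAbove_zero, Fin.val_succ]
      rw [mul_assoc (revProd _) (v 0), hv, mul_neg, mul_neg, smul_mul_assoc, add_right_comm,
        pow_succ, mul_neg_one, neg_smul, smul_neg, neg_neg, mul_assoc, mul_assoc]
    rw [Fin.sum_univ_succ]
    have e0 : ∀ t : Fin (l + 1), (-1 : ℝ) ^ (((0 : Fin (k + 2)) : ℕ) + t : ℕ) •
        (revProd (fun r => w (t.succAbove r)) *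
          (revProd (fun r => v ((0 : Fin (k + 2)).succAbove r)) * c 0 t)) =
        (-1 : ℝ) ^ (t : ℕ) • (revProd (fun r => w (t.succAbove r)) * (A * c 0 t)) := by
      intro t
      simp [hA]
    rw [Finset.sum_congr rfl fun t _ => e0 t, e1, e2, revProd_succ v, ← hA, gradedLie_mul, ← hL]
    simp only [add_mul, mul_add, mul_sub, sub_mul, smul_add, smul_sub, mul_smul_comm,
      smul_mul_assoc, smul_smul]
    rw [mul_assoc L (v 0) B, h3, ← mul_assoc B A, h4]
    simp only [mul_smul_comm, smul_mul_assoc, smul_smul, mul_assoc]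
    -- Both sides are combinations of the same words, with signs depending only on the parities of
    -- `k` and `l`.
    rcases neg_one_pow_eq_or ℝ k with hk | hk <;> rcases neg_one_pow_eq_or ℝ l with hl | hl <;>
      simp only [mul_add, add_mul, pow_add, pow_mul, hk, hl, one_mul, mul_one, pow_one, one_pow,
        neg_one_smul, one_smul, mul_neg, neg_neg, mul_comm l k] <;> abel

/-- The bracket `(-1)^(i(j+1)) L_x y - y L_x` of operators of degrees `-(i+1)` and `-(j+1)`. -/
def derivedBracket (d : R) (i j : ℕ) (x y : R) : R :=
  (-1 : ℝ) ^ (i * (j + 1)) • (gradedLie d (i + 1) x * y) - y * gradedLie d (i + 1) x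

set_option linter.unusedSimpArgs false in
-- Once `x * y` is replaced by `± y * x`, both sides are combinations of `d y x`, `x d y`, `y d x`
-- and `y x d`; nothing about `d` is needed.
theorem derivedBracket_skew (d : R) {i j : ℕ} {x y : R}
    (h : x * y = (-1 : ℝ) ^ ((i + 1) * (j + 1)) • (y * x)) :
    derivedBracket d i j x y = -((-1 : ℝ) ^ (i * j) • derivedBracket d j i y x) := by
  have h' : ∀ w, x * (y * w) = (-1 : ℝ) ^ ((i + 1) * (j + 1)) • (y * (x * w)) := fun w => by
    rw [← mul_assoc, h, smul_mul_assoc, mul_assoc]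
  simp only [derivedBracket, gradedLie, sub_mul, mul_sub, smul_mul_assoc, mul_smul_comm, mul_assoc,
    h, h']
  rcases neg_one_pow_eq_or ℝ i with hi | hi <;> rcases neg_one_pow_eq_or ℝ j with hj | hj <;>
    simp only [mul_add, add_mul, pow_add, pow_mul, hi, hj, one_mul, mul_one, pow_one, one_pow,
      neg_one_smul, one_smul, mul_neg, neg_neg, smul_neg, neg_mul, mul_comm j i] <;> abel

set_option linter.unusedSimpArgs false in
-- Because `d² = 0`, the operator `gradedLie d (i + 1) x` commutes with `d` up to sign. So the
-- graded commutator with `d` acts only on the factor `y` of the bracket.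
theorem gradedLie_derivedBracket {d : R} (hd : d * d = 0) (i j : ℕ) (x y : R) :
    gradedLie d (i + j + 1) (derivedBracket d i j x y) =
      (-1 : ℝ) ^ (i * j) • (gradedLie d (i + 1) x * gradedLie d (j + 1) y) -
        gradedLie d (j + 1) y * gradedLie d (i + 1) x := by
  have hd' : ∀ w, d * (d * w) = 0 := fun w => by rw [← mul_assoc, hd, zero_mul]
  rcases neg_one_pow_eq_or ℝ i with hi | hi <;> rcases neg_one_pow_eq_or ℝ j with hj | hj <;>
    simp only [derivedBracket, gradedLie, sub_mul, mul_sub, smul_mul_assoc, mul_smul_comm,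
      mul_assoc, hd, hd', mul_add, add_mul, pow_add, pow_mul, hi, hj, one_mul, mul_one, pow_one,
      one_pow, neg_smul, one_smul, mul_neg, neg_neg, smul_neg, neg_mul, mul_comm j i, mul_zero,
      sub_neg_eq_add, neg_zero, smul_zero] <;> abel

set_option linter.unusedSimpArgs false in
-- Skew-symmetry makes `z` the last argument throughout. Each term is then a combination of words in
-- `z` and the Lie derivatives `a`, `b` of `x`, `y`, as that of the bracket of `x` and `y` is the
-- graded commutator of `a` and `b`; the words cancel.
theorem derivedBracket_jacobi {d : R} (hd : d * d = 0) {i j k : ℕ} {x y z : R}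
    (hzx : z * x = (-1 : ℝ) ^ ((k + 1) * (i + 1)) • (x * z))
    (hz : z * derivedBracket d i j x y =
      (-1 : ℝ) ^ ((k + 1) * (i + j + 1)) • (derivedBracket d i j x y * z)) :
    (-1 : ℝ) ^ (i * k) • derivedBracket d i (j + k) x (derivedBracket d j k y z) +
      (-1 : ℝ) ^ (j * i) • derivedBracket d j (k + i) y (derivedBracket d k i z x) +
      (-1 : ℝ) ^ (k * j) • derivedBracket d k (i + j) z (derivedBracket d i j x y) = 0 := by
  rw [derivedBracket_skew d hz, derivedBracket_skew d hzx]
  have h := gradedLie_derivedBracket hd i j x y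
  generalize derivedBracket d i j x y = w at h
  simp only [derivedBracket, h]
  generalize gradedLie d (i + 1) x = a
  generalize gradedLie d (j + 1) y = b
  rcases neg_one_pow_eq_or ℝ i with hi | hi <;> rcases neg_one_pow_eq_or ℝ j with hj | hj <;>
    rcases neg_one_pow_eq_or ℝ k with hk | hk <;>
    simp only [sub_mul, mul_sub, smul_mul_assoc, mul_smul_comm, mul_assoc, mul_add, add_mul,
      pow_add, pow_mul, hi, hj, hk, one_mul, mul_one, pow_one, one_pow, neg_smul, one_smul,
      mul_neg, neg_neg, smul_neg, neg_mul, sub_neg_eq_add] <;> abel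

end GradedOperators

end

end Multisymplectic
namespace Multisymplectic

noncomputable section

/-! ### Cartan calculus for forms on a normed space -/

section Calculus

variable {E : Type*} [NormedAddCommGroup E] [NormedSpace ℝ E]

theorem hasFDerivAt_curryLeft {q : ℕ} {f : E → E [⋀^Fin (q + 1)]→L[ℝ] ℝ} {y : E}
    (hf : DifferentiableAt ℝ f y) :
    HasFDerivAt (fun z => (f z).curryLeft)
      ((ContinuousAlternatingMap.curryLeftLI.toContinuousLinearMap :
        (E [⋀^Fin (q + 1)]→L[ℝ] ℝ) →L[ℝ] E →L[ℝ] E [⋀^Fin q]→L[ℝ] ℝ).comp (fderiv ℝ f y)) y := by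
  let C : (E [⋀^Fin (q + 1)]→L[ℝ] ℝ) →L[ℝ] E →L[ℝ] E [⋀^Fin q]→L[ℝ] ℝ :=
    ContinuousAlternatingMap.curryLeftLI.toContinuousLinearMap
  have h := ContinuousLinearMap.hasFDerivAt (F := E →L[ℝ] E [⋀^Fin q]→L[ℝ] ℝ) C (x := f y)
  exact HasFDerivAt.comp (G := E →L[ℝ] E [⋀^Fin q]→L[ℝ] ℝ) y h hf.hasFDerivAt

theorem fderiv_curryLeft_apply {q : ℕ} {f : E → E [⋀^Fin (q + 1)]→L[ℝ] ℝ} {V : E → E} {y : E}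
    (hf : DifferentiableAt ℝ f y) (hV : DifferentiableAt ℝ V y) (a : E) (u : Fin q → E) :
    fderiv ℝ (fun z => (f z).curryLeft (V z)) y a u =
      fderiv ℝ f y a (Fin.cons (V y) u) + f y (Fin.cons (fderiv ℝ V y a) u) := by
  rw [((hasFDerivAt_curryLeft hf).clm_apply hV.hasFDerivAt).fderiv]
  simp only [add_apply, ContinuousLinearMap.comp_apply,
    ContinuousLinearMap.flip_apply, ContinuousAlternatingMap.add_apply]
  exact add_comm _ _

/-- The Lie derivative at `y` of a form `f` along a vector field with value `a` and derivative `A`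
at `y`. -/
def lieRep {p : ℕ} (f : E → E [⋀^Fin p]→L[ℝ] ℝ) (y a : E) (A : E →L[ℝ] E) (w : Fin p → E) : ℝ :=
  fderiv ℝ f y a w + ∑ i, f y (Function.update w i (A (w i)))

theorem extDeriv_apply_cons {q : ℕ} {f : E → E [⋀^Fin q]→L[ℝ] ℝ} {y : E} (a : E) (w : Fin q → E) :
    extDeriv f y (Fin.cons a w) = fderiv ℝ f y a w -
      ∑ i : Fin q, (-1 : ℝ) ^ (i : ℕ) • fderiv ℝ f y (w i)
        (i.succ.removeNth (Fin.cons a w : Fin (q + 1) → E)) := by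
  rw [extDeriv, ContinuousAlternatingMap.alternatizeUncurryFin_apply, Fin.sum_univ_succ,
    sub_eq_add_neg, ← Finset.sum_neg_distrib]
  congr 1
  · simp
  · refine Finset.sum_congr rfl fun i _ => ?_
    simp [pow_succ]

/-- Cartan's formula in degree zero: there is no contraction to differentiate and no slot for `A` to
act on. -/
theorem extDeriv_cons_zero {f : E → E [⋀^Fin 0]→L[ℝ] ℝ} {y a : E} (A : E →L[ℝ] E) (w : Fin 0 → E) :
    extDeriv f y (Fin.cons a w) = lieRep f y a A w := by
  rw [extDeriv_apply_cons, lieRep]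
  simp

/-- Cartan's formula for the Lie derivative. -/
theorem extDeriv_curryLeft_add {q : ℕ} {f : E → E [⋀^Fin (q + 1)]→L[ℝ] ℝ} {V : E → E} {y : E}
    (hf : DifferentiableAt ℝ f y) (hV : DifferentiableAt ℝ V y) (w : Fin (q + 1) → E) :
    extDeriv (fun z => (f z).curryLeft (V z)) y w + extDeriv f y (Fin.cons (V y) w) =
      lieRep f y (V y) (fderiv ℝ V y) w := by
  rw [extDeriv_apply_cons, lieRep, extDeriv, ContinuousAlternatingMap.alternatizeUncurryFin_apply,
    add_sub_left_comm, ← Finset.sum_sub_distrib]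
  congr 1
  -- In direction `w i` both `f` and `V` are differentiated. The derivative of `f` cancels against
  -- the `i`-th term of `extDeriv f`. The derivative of `V` leaves a vector in the first slot of
  -- `f`, which `map_insertNth` relates to slot `i` with the sign `(-1)^i`.
  refine Finset.sum_congr rfl fun i _ => ?_
  rw [fderiv_curryLeft_apply hf hV, ← Fin.insertNth_removeNth,
    ContinuousAlternatingMap.map_insertNth]
  have : i.succ.removeNth (Fin.cons (V y) w : Fin (q + 2) → E) =
      Fin.cons (V y) (i.removeNth w) := by
    funext j
    refine Fin.cases ?_ (fun j => ?_) j <;> simp [Fin.removeNth]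
  rw [this]
  have hs : ∀ r : ℝ, (-1 : ℤ) ^ (i : ℕ) • r = (-1 : ℝ) ^ (i : ℕ) * r := by
    intro r; simp
  have hs' : ∀ r : ℝ, (-1 : ℤˣ) ^ (i : ℕ) • r = (-1 : ℝ) ^ (i : ℕ) * r := by
    intro r; simp [Units.smul_def]
  simp only [hs, smul_eq_mul, mul_add, add_sub_cancel_left]
  rfl

/-- The commutator of a Lie derivative and a contraction is the contraction by the Lie bracket. -/
theorem lieRep_curryLeft {q : ℕ} {f : E → E [⋀^Fin (q + 1)]→L[ℝ] ℝ} {V W : E → E} {y : E}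
    (hf : DifferentiableAt ℝ f y) (hW : DifferentiableAt ℝ W y) (w : Fin q → E) :
    lieRep (fun z => (f z).curryLeft (W z)) y (V y) (fderiv ℝ V y) w -
      lieRep f y (V y) (fderiv ℝ V y) (Fin.cons (W y) w) =
      f y (Fin.cons (VectorField.lieBracket ℝ V W y) w) := by
  -- The product rule contributes `DW(V)` in the first slot and the slot occupied by `W y`
  -- contributes `DV(W)`; their difference is the Lie bracket. All other terms cancel.
  rw [lieRep, lieRep, fderiv_curryLeft_apply hf hW, Fin.sum_univ_succ]
  simp only [Fin.update_cons_zero, Fin.cons_zero, Fin.cons_succ, ← Fin.cons_update,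
    VectorField.lieBracket]
  have h1 : f y (Fin.cons (fderiv ℝ W y (V y) - fderiv ℝ V y (W y)) w) =
      f y (Fin.cons (fderiv ℝ W y (V y)) w) - f y (Fin.cons (fderiv ℝ V y (W y)) w) := by
    have := congrArg (fun g => g w) (map_sub (f y).curryLeft (fderiv ℝ W y (V y)) (fderiv ℝ V y (W y)))
    exact this
  rw [h1]
  have h2 : ∀ u, ((f y).curryLeft (W y)) u = f y (Fin.cons (W y) u) := fun _ => rfl
  simp only [h2]
  ring

end Calculus

end

end Multisymplectic
namespace Multisymplectic

noncomputable section

/-! ### Contraction and the exterior algebra of one vector space -/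

section Pointwise

variable {V : Type*} [AddCommGroup V] [Module ℝ V] [TopologicalSpace V] [IsTopologicalAddGroup V]
  [ContinuousSMul ℝ V] [T2Space V] [FiniteDimensional ℝ V]

theorem pairing_contractAt (X Z : ExteriorAlgebra ℝ V) (τ : ∀ p, V [⋀^Fin p]→L[ℝ] ℝ) :
    pairing (fun q => contractAt X τ q) Z = pairing τ (X * Z) := by
  have : pairing (fun q => contractAt X τ q) = pairing τ ∘ₗ LinearMap.mulLeft ℝ X := by
    apply ExteriorAlgebra.lhom_ext
    intro q
    ext w
    simp only [LinearMap.compAlternatingMap_apply, pairing,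
      ExteriorAlgebra.liftAlternating_apply_ιMulti]
    rfl
  exact LinearMap.congr_fun this Z

/-- Both sides evaluate `τ` on `X * Y * (w₁ ∧ ⋯ ∧ w_q)`. Products thus become compositions in the
opposite order, whence `revProd`. -/
theorem contractAt_contractAt (X Y : ExteriorAlgebra ℝ V) (τ : ∀ p, V [⋀^Fin p]→L[ℝ] ℝ) (q : ℕ) :
    contractAt Y (fun q => contractAt X τ q) q = contractAt (X * Y) τ q := by
  ext w
  rw [contractAt_apply, contractAt_apply, pairing_contractAt, mul_assoc]

theorem contractAt_one (τ : ∀ p, V [⋀^Fin p]→L[ℝ] ℝ) (q : ℕ) : contractAt 1 τ q = τ q := by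
  ext w
  rw [contractAt_apply, one_mul, pairing, ExteriorAlgebra.liftAlternating_apply_ιMulti]
  rfl

theorem contractAt_ι (v : V) (τ : ∀ p, V [⋀^Fin p]→L[ℝ] ℝ) (q : ℕ) (w : Fin q → V) :
    contractAt (ExteriorAlgebra.ι ℝ v) τ q w = τ (q + 1) (Fin.cons v w) := by
  have : ExteriorAlgebra.ι ℝ v * ExteriorAlgebra.ιMulti ℝ q w =
      ExteriorAlgebra.ιMulti ℝ (q + 1) (Fin.cons v w : Fin (q + 1) → V) := by
    rw [ExteriorAlgebra.ιMulti_succ_apply]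
    rfl
  rw [contractAt_apply, this, pairing, ExteriorAlgebra.liftAlternating_apply_ιMulti]
  rfl

/-- Alternating forms separate the elements of the exterior algebra. -/
theorem eq_of_pairing_eq {X Y : ExteriorAlgebra ℝ V}
    (h : ∀ τ : ∀ p, V [⋀^Fin p]→L[ℝ] ℝ, pairing τ X = pairing τ Y) : X = Y := by
  rw [← sub_eq_zero, ← Module.forall_dual_apply_eq_zero_iff ℝ]
  intro φ
  -- Every linear functional `φ` is a pairing: take the family of alternating forms `φ ∘ ιMulti`.
  have hφ := ExteriorAlgebra.liftAlternating_comp (R := ℝ) φ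
    (fun p => ExteriorAlgebra.ιMulti (M := V) ℝ p)
  rw [ExteriorAlgebra.liftAlternating_ιMulti, LinearMap.comp_id] at hφ
  have h1 := h fun p =>
    { φ.compAlternatingMap (ExteriorAlgebra.ιMulti ℝ p) with cont := continuous_alternating _ }
  have h2 : pairing (fun p => ({ φ.compAlternatingMap (ExteriorAlgebra.ιMulti ℝ p) with
      cont := continuous_alternating _ } : V [⋀^Fin p]→L[ℝ] ℝ)) = φ := by
    exact Eq.trans rfl hφ
  rw [h2] at h1
  rw [map_sub, h1, sub_self]

end Pointwise

/-! ### Multivector fields as operators on forms -/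

variable {E : Type*} [NormedAddCommGroup E] [NormedSpace ℝ E] [FiniteDimensional ℝ E]
  {M : Type*} [TopologicalSpace M] [ChartedSpace E M] [IsManifold 𝓘(ℝ, E) ∞ M]

/-- The wedge of `j + 1` vector fields, as a multivector field. -/
def wedgeField {j : ℕ} (V : Fin (j + 1) → VecField E M) : MultiVec E M j :=
  ⟨wedge V, fun _ => ⟨[V], by simp⟩⟩

/-- The contraction by a vector field. -/
def insert (V : VecField E M) : Module.End ℝ (Forms E M) := contract (wedgeField fun _ : Fin 1 => V)

theorem contract_apply_apply {j : ℕ} (X : MultiVec E M j) (τ : Forms E M) (q : ℕ) (x : M) :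
    contract X τ q x = contractAt (X.1 x) (fun p => τ p x) q := rfl

theorem Forms.ext {τ σ : Forms E M} (h : ∀ p x, τ p x = σ p x) : τ = σ := by
  funext p
  ext x : 1
  exact h p x

theorem insert_apply_apply (V : VecField E M) (τ : Forms E M) (q : ℕ) (x : M) :
    insert V τ q x = contractAt (ExteriorAlgebra.ι ℝ (V x)) (fun p => τ p x) q := by
  rw [insert, contract_apply_apply]
  simp [wedgeField, wedge, ExteriorAlgebra.ιMulti_apply]

theorem revProd_insert_apply {k : ℕ} (V : Fin k → VecField E M) (τ : Forms E M) (q : ℕ) (x : M) :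
    revProd (fun i => insert (V i)) τ q x = contractAt (wedge V x) (fun p => τ p x) q := by
  induction k generalizing τ with
  | zero => simp [wedge, contractAt_one]
  | succ k ih =>
    rw [revProd_succ, Module.End.mul_apply, ih]
    simp only [insert_apply_apply]
    rw [contractAt_contractAt]
    simp only [wedge]
    rw [ExteriorAlgebra.ιMulti_succ_apply]
    rfl

theorem contract_wedgeField {j : ℕ} (V : Fin (j + 1) → VecField E M) :
    contract (wedgeField V) = revProd fun i => insert (V i) := by
  ext τ : 1
  refine Forms.ext fun p x => ?_
  rw [revProd_insert_apply]
  rfl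

theorem insert_mul_insert (V W : VecField E M) : insert V * insert W = -(insert W * insert V) := by
  ext τ : 1
  refine Forms.ext fun p x => ?_
  have e : ExteriorAlgebra.ι ℝ (W x) * ExteriorAlgebra.ι ℝ (V x) =
      (-1 : ℝ) • (ExteriorAlgebra.ι ℝ (V x) * ExteriorAlgebra.ι ℝ (W x)) := by
    rw [neg_one_smul]
    exact eq_neg_of_add_eq_zero_left (ExteriorAlgebra.ι_add_mul_swap (W x) (V x))
  have h : insert V (insert W τ) p x = -insert W (insert V τ) p x := by
    rw [insert_apply_apply, insert_apply_apply]
    simp only [insert_apply_apply]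
    rw [contractAt_contractAt, contractAt_contractAt, e, contractAt_smul_left]
    exact neg_one_smul (M := TangentSpace 𝓘(ℝ, E) x [⋀^Fin p]→L[ℝ] ℝ) ℝ _
  exact h

/-! ### Locality -/

/-- Two forms agree near a point. -/
def AgreeNear (x₀ : M) (τ σ : Forms E M) : Prop := ∀ᶠ x in 𝓝 x₀, ∀ p, τ p x = σ p x

theorem AgreeNear.eq {x₀ : M} {τ σ : Forms E M} (h : AgreeNear x₀ τ σ) (p : ℕ) :
    τ p x₀ = σ p x₀ := h.self_of_nhds p

theorem AgreeNear.contract {x₀ : M} {τ σ : Forms E M} (h : AgreeNear x₀ τ σ) {j : ℕ}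
    {X Y : MultiVec E M j} (hX : ∀ᶠ x in 𝓝 x₀, X.1 x = Y.1 x) :
    AgreeNear x₀ (contract X τ) (contract Y σ) := by
  filter_upwards [h, hX] with x h1 h2 p
  rw [contract_apply_apply, contract_apply_apply, h2]
  simp only [h1]

theorem tendsto_extChartAt_symm (x₀ : M) :
    Tendsto (extChartAt 𝓘(ℝ, E) x₀).symm (𝓝 (extChartAt 𝓘(ℝ, E) x₀ x₀)) (𝓝 x₀) := by
  have := continuousAt_extChartAt_symm (I := 𝓘(ℝ, E)) x₀
  rwa [ContinuousAt, extChartAt_to_inv] at this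

theorem AgreeNear.d {x₀ : M} {τ σ : Forms E M} (h : AgreeNear x₀ τ σ) :
    AgreeNear x₀ (Forms.d τ) (Forms.d σ) := by
  filter_upwards [h.eventually_nhds] with x hx p
  cases p with
  | zero => rfl
  | succ p =>
    change extDerivAt (τ p) x = extDerivAt (σ p) x
    have h1 : chartRep x (τ p) =ᶠ[𝓝 (extChartAt 𝓘(ℝ, E) x x)] chartRep x (σ p) := by
      filter_upwards [(tendsto_extChartAt_symm x).eventually hx] with y hy
      rw [chartRep, chartRep, hy p]
    rw [extDerivAt, extDerivAt, h1.extDeriv_eq]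

theorem AgreeNear.sub {x₀ : M} {τ σ τ' σ' : Forms E M} (h : AgreeNear x₀ τ σ)
    (h' : AgreeNear x₀ τ' σ') : AgreeNear x₀ (τ - τ') (σ - σ') := by
  filter_upwards [h, h'] with x h1 h2 p
  change τ p x - τ' p x = σ p x - σ' p x
  rw [h1, h2]

theorem AgreeNear.smul {x₀ : M} {τ σ : Forms E M} (h : AgreeNear x₀ τ σ) (c : ℝ) :
    AgreeNear x₀ (c • τ) (c • σ) := by
  filter_upwards [h] with x h1 p
  change c • τ p x = c • σ p x
  rw [h1]

/-! ### Forms in charts -/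

theorem eq_of_chartRep_eq {p : ℕ} {τ σ : ∀ x : M, TangentSpace 𝓘(ℝ, E) x [⋀^Fin p]→L[ℝ] ℝ}
    {x₀ : M} (h : chartRep x₀ τ (extChartAt 𝓘(ℝ, E) x₀ x₀) =
      chartRep x₀ σ (extChartAt 𝓘(ℝ, E) x₀ x₀)) : τ x₀ = σ x₀ := by
  have hinv := isInvertible_mfderivWithin_extChartAt_symm (I := 𝓘(ℝ, E))
    (mem_extChartAt_target x₀)
  rw [ModelWithCorners.Boundaryless.range_eq_univ, mfderivWithin_univ] at hinv
  -- The inverse chart returns `x₀` only propositionally, and the fibres depend on the base point; a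
  -- general `x` allows substitution instead of a cast.
  have key : ∀ x, x = x₀ → τ x = σ x → τ x₀ = σ x₀ := by
    rintro x rfl h
    exact h
  refine key _ (extChartAt_to_inv (I := 𝓘(ℝ, E)) x₀) ?_
  ext v
  have hv : v = fun i => mfderiv 𝓘(ℝ, E) 𝓘(ℝ, E) (extChartAt 𝓘(ℝ, E) x₀).symm
      (extChartAt 𝓘(ℝ, E) x₀ x₀) ((mfderiv 𝓘(ℝ, E) 𝓘(ℝ, E) (extChartAt 𝓘(ℝ, E) x₀).symm
      (extChartAt 𝓘(ℝ, E) x₀ x₀)).inverse (v i)) := by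
    funext i
    exact (hinv.self_apply_inverse _).symm
  rw [hv]
  exact congrArg (fun g => g fun i => (mfderiv 𝓘(ℝ, E) 𝓘(ℝ, E) (extChartAt 𝓘(ℝ, E) x₀).symm
      (extChartAt 𝓘(ℝ, E) x₀ x₀)).inverse (v i)) h

/-- The square of the exterior derivative is zero. -/
theorem Forms.d_d (τ : Forms E M) : Forms.d (Forms.d τ) = 0 := by
  refine Forms.ext fun p x => ?_
  -- In degrees 0 and 1 the component vanishes because `Forms.d` is zero in degree 0. From degree 2
  -- on the chart reduces the claim to `extDeriv`.
  match p with
  | 0 => rfl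
  | 1 =>
    refine (congrArg (fun σ : Form E M 1 => σ x) (map_zero Form.d))
  | p + 2 =>
    refine eq_of_chartRep_eq (τ := fun x => Forms.d (Forms.d τ) (p + 2) x)
      (σ := fun _ => 0) (x₀ := x) ?_
    have h1 := (Form.d (τ p)).chartRep_extDerivAt x (mem_extChartAt_target x)
    have h2 : chartRep x (Form.d (τ p)) =ᶠ[𝓝 (extChartAt 𝓘(ℝ, E) x x)]
        extDeriv (chartRep x (τ p)) := by
      filter_upwards [(isOpen_extChartAt_target (I := 𝓘(ℝ, E)) x).mem_nhds
        (mem_extChartAt_target x)] with y hy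
      exact (τ p).chartRep_extDerivAt x hy
    rw [h2.extDeriv_eq, extDeriv_extDeriv_apply
      ((τ p).contDiffAt_chartRep x (mem_extChartAt_target x))
      (by rw [minSmoothness_of_isRCLikeNormedField]; exact WithTop.coe_le_coe.2 le_top)] at h1
    exact h1

/-- The expression of a vector field in the chart at `x₀`. -/
def vecRep (x₀ : M) (V : ∀ x : M, TangentSpace 𝓘(ℝ, E) x) : E → E :=
  fun y => VectorField.mpullback 𝓘(ℝ, E) 𝓘(ℝ, E) (extChartAt 𝓘(ℝ, E) x₀).symm V y

theorem mfderiv_vecRep (x₀ : M) (V : ∀ x : M, TangentSpace 𝓘(ℝ, E) x) {y : E}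
    (hy : y ∈ (extChartAt 𝓘(ℝ, E) x₀).target) :
    mfderiv 𝓘(ℝ, E) 𝓘(ℝ, E) (extChartAt 𝓘(ℝ, E) x₀).symm y (vecRep x₀ V y : E) =
      V ((extChartAt 𝓘(ℝ, E) x₀).symm y) := by
  have hinv := isInvertible_mfderivWithin_extChartAt_symm (I := 𝓘(ℝ, E)) hy
  rw [ModelWithCorners.Boundaryless.range_eq_univ, mfderivWithin_univ] at hinv
  change mfderiv 𝓘(ℝ, E) 𝓘(ℝ, E) (extChartAt 𝓘(ℝ, E) x₀).symm y
    (VectorField.mpullback 𝓘(ℝ, E) 𝓘(ℝ, E) (extChartAt 𝓘(ℝ, E) x₀).symm V y) = _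
  rw [VectorField.mpullback_apply]
  exact hinv.self_apply_inverse _

theorem differentiableAt_vecRep (x₀ : M) (V : VecField E M) :
    DifferentiableAt ℝ (vecRep x₀ V) (extChartAt 𝓘(ℝ, E) x₀ x₀) := by
  have htgt := (isOpen_extChartAt_target (I := 𝓘(ℝ, E)) x₀).mem_nhds (mem_extChartAt_target x₀)
  have h1 := VectorField.contMDiffWithinAt_mpullbackWithin_extChartAt_symm (m := ∞) (n := ∞)
    (s := univ) (V.contMDiff.contMDiffAt (x := x₀)).contMDiffWithinAt uniqueMDiffOn_univ
    (mem_univ _) (by simp)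
  simp only [preimage_univ, inter_univ, ModelWithCorners.Boundaryless.range_eq_univ,
    VectorField.mpullbackWithin_univ] at h1
  have h2 := h1.contMDiffAt htgt
  rw [← contMDiffWithinAt_univ, contMDiffWithinAt_vectorSpace_iff_contDiffWithinAt] at h2
  have h3 : ContDiffAt ℝ ∞ (vecRep x₀ V) (extChartAt 𝓘(ℝ, E) x₀ x₀) := h2
  exact h3.differentiableAt (by simp)

theorem isManifold_minSmoothness : IsManifold 𝓘(ℝ, E) (minSmoothness ℝ 2) M :=
  IsManifold.of_le (n := ∞)
    (by rw [minSmoothness_of_isRCLikeNormedField]; exact WithTop.coe_le_coe.2 le_top)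

theorem vecRep_mlieBracket (x₀ : M) (V W : VecField E M) :
    vecRep x₀ (VectorField.mlieBracket 𝓘(ℝ, E) V W) (extChartAt 𝓘(ℝ, E) x₀ x₀) =
      VectorField.lieBracket ℝ (vecRep x₀ V) (vecRep x₀ W) (extChartAt 𝓘(ℝ, E) x₀ x₀) := by
  have hc := (contMDiffOn_extChartAt_symm (I := 𝓘(ℝ, E)) (n := ∞) x₀).contMDiffAt
    ((isOpen_extChartAt_target (I := 𝓘(ℝ, E)) x₀).mem_nhds (mem_extChartAt_target x₀))
  have := isManifold_minSmoothness (E := E) (M := M)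
  have h := VectorField.mpullback_mlieBracket (I := 𝓘(ℝ, E)) (I' := 𝓘(ℝ, E)) (V := V) (W := W)
    (V.contMDiff.mdifferentiable (by simp) _) (W.contMDiff.mdifferentiable (by simp) _) hc
    (by rw [minSmoothness_of_isRCLikeNormedField]; exact WithTop.coe_le_coe.2 le_top)
  refine h.trans ?_
  rw [← VectorField.mlieBracketWithin_univ, VectorField.mlieBracketWithin_eq_lieBracketWithin]
  exact congrFun (VectorField.lieBracketWithin_univ (𝕜 := ℝ) (V := vecRep x₀ V)
    (W := vecRep x₀ W)) _

theorem chartRep_insert (V : VecField E M) (τ : Forms E M) (q : ℕ) (x₀ : M) {y : E}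
    (hy : y ∈ (extChartAt 𝓘(ℝ, E) x₀).target) :
    chartRep x₀ (insert V τ q) y = (chartRep x₀ (τ (q + 1)) y).curryLeft (vecRep x₀ V y) := by
  ext w
  rw [ContinuousAlternatingMap.curryLeft_apply_apply]
  change insert V τ q ((extChartAt 𝓘(ℝ, E) x₀).symm y)
    (fun i => mfderiv 𝓘(ℝ, E) 𝓘(ℝ, E) (extChartAt 𝓘(ℝ, E) x₀).symm y (w i)) =
    τ (q + 1) ((extChartAt 𝓘(ℝ, E) x₀).symm y) (fun i =>
      mfderiv 𝓘(ℝ, E) 𝓘(ℝ, E) (extChartAt 𝓘(ℝ, E) x₀).symm y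
        ((Matrix.vecCons (vecRep x₀ V y) w : Fin (q + 1) → E) i))
  rw [insert_apply_apply, contractAt_ι]
  congr 1
  funext i
  refine Fin.cases ?_ (fun i => ?_) i
  · exact (mfderiv_vecRep x₀ V hy).symm
  · rfl

/-- Cartan's formula read in a chart. The centre of the chart suffices, since identities of forms
are later checked at each point in its own chart. -/
theorem chartRep_lie (V : VecField E M) (τ : Forms E M) (q : ℕ) (x₀ : M) (w : Fin q → E) :
    chartRep x₀ (gradedLie Forms.d 1 (insert V) τ q) (extChartAt 𝓘(ℝ, E) x₀ x₀) w =
      lieRep (chartRep x₀ (τ q)) (extChartAt 𝓘(ℝ, E) x₀ x₀)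
        (vecRep x₀ V (extChartAt 𝓘(ℝ, E) x₀ x₀))
        (fderiv ℝ (vecRep x₀ V) (extChartAt 𝓘(ℝ, E) x₀ x₀)) w := by
  have hy := mem_extChartAt_target (I := 𝓘(ℝ, E)) x₀
  have h0 : gradedLie Forms.d 1 (insert V) τ = Forms.d (insert V τ) + insert V (Forms.d τ) := by
    simp [gradedLie]
  have h1 : chartRep x₀ (insert V (Forms.d τ) q) (extChartAt 𝓘(ℝ, E) x₀ x₀) w =
      extDeriv (chartRep x₀ (τ q)) (extChartAt 𝓘(ℝ, E) x₀ x₀)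
        (Fin.cons (vecRep x₀ V (extChartAt 𝓘(ℝ, E) x₀ x₀)) w) := by
    rw [chartRep_insert V _ q x₀ hy, ← (τ q).chartRep_extDerivAt x₀ hy]
    rfl
  rw [h0]
  change chartRep x₀ (Forms.d (insert V τ) q) (extChartAt 𝓘(ℝ, E) x₀ x₀) w +
    chartRep x₀ (insert V (Forms.d τ) q) (extChartAt 𝓘(ℝ, E) x₀ x₀) w = _
  rw [h1]
  cases q with
  -- The form `d(V ⌟ τ)` has no component of degree 0, so only `V ⌟ dτ` remains.
  | zero =>
    rw [extDeriv_cons_zero (fderiv ℝ (vecRep x₀ V) (extChartAt 𝓘(ℝ, E) x₀ x₀))]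
    exact zero_add _
  | succ q =>
    rw [← extDeriv_curryLeft_add
      (((τ (q + 1)).contDiffAt_chartRep x₀ hy).differentiableAt (by simp))
      (differentiableAt_vecRep x₀ V)]
    congr 1
    refine (congrArg (fun g => g w) ((insert V τ q).chartRep_extDerivAt x₀ hy)).trans ?_
    have h2 : chartRep x₀ (insert V τ q) =ᶠ[𝓝 (extChartAt 𝓘(ℝ, E) x₀ x₀)]
        fun y => (chartRep x₀ (τ (q + 1)) y).curryLeft (vecRep x₀ V y) := by
      filter_upwards [(isOpen_extChartAt_target (I := 𝓘(ℝ, E)) x₀).mem_nhds hy] with y hy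
      exact chartRep_insert V τ q x₀ hy
    exact congrArg (fun g => g w) h2.extDeriv_eq

/-- The Lie bracket of two smooth vector fields. -/
def VecField.bracket (V W : VecField E M) : VecField E M :=
  ⟨VectorField.mlieBracket 𝓘(ℝ, E) V W, by
    have := isManifold_minSmoothness (E := E) (M := M)
    have : IsManifold 𝓘(ℝ, E) ((⊤ : ℕ∞) + 1) M := inferInstanceAs (IsManifold 𝓘(ℝ, E) ∞ M)
    exact ContDiff.mlieBracket_vectorField (m := ⊤) (n := ⊤) V.contMDiff W.contMDiff (by simp)⟩

theorem chartRep_sub_apply (τ σ : Forms E M) (q : ℕ) (x₀ : M) (y : E) (w : Fin q → E) :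
    chartRep x₀ ((τ - σ) q) y w = chartRep x₀ (τ q) y w - chartRep x₀ (σ q) y w := rfl

/-- The geometric input to the Schouten bracket: at each point, in the chart centred there, it is
`lieRep_curryLeft`, and the chart respects Lie brackets by `vecRep_mlieBracket`. -/
theorem gradedLie_insert_commutator (V W : VecField E M) :
    gradedLie Forms.d 1 (insert V) * insert W - insert W * gradedLie Forms.d 1 (insert V) =
      insert (V.bracket W) := by
  ext τ : 1
  rw [LinearMap.sub_apply, Module.End.mul_apply, Module.End.mul_apply]
  refine Forms.ext fun q x => ?_
  refine eq_of_chartRep_eq (x₀ := x) ?_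
  have hy := mem_extChartAt_target (I := 𝓘(ℝ, E)) x
  ext w
  have h1 := chartRep_lie V (insert W τ) q x w
  have h2 := congrArg (fun g => g w)
    (chartRep_insert W (gradedLie Forms.d 1 (insert V) τ) q x hy)
  have h3 := congrArg (fun g => g w) (chartRep_insert (V.bracket W) τ q x hy)
  have h4 : chartRep x (insert W τ q) =ᶠ[𝓝 (extChartAt 𝓘(ℝ, E) x x)]
      fun y => (chartRep x (τ (q + 1)) y).curryLeft (vecRep x W y) := by
    filter_upwards [(isOpen_extChartAt_target (I := 𝓘(ℝ, E)) x).mem_nhds hy] with y hy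
    exact chartRep_insert W τ q x hy
  have h5 := lieRep_curryLeft (V := vecRep x V)
    (((τ (q + 1)).contDiffAt_chartRep x hy).differentiableAt (by simp))
    (differentiableAt_vecRep x W) w
  have h6 : vecRep x (V.bracket W) (extChartAt 𝓘(ℝ, E) x x) = _ := vecRep_mlieBracket x V W
  have h7 := chartRep_lie V τ (q + 1) x
    (Fin.cons (vecRep x W (extChartAt 𝓘(ℝ, E) x x)) w : Fin (q + 1) → E)
  -- `lieRep` contains a derivative, so the chart expression of `insert W τ` is needed near the
  -- point, as in `h4`.
  have h8 : lieRep (chartRep x (insert W τ q)) (extChartAt 𝓘(ℝ, E) x x)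
      (vecRep x V (extChartAt 𝓘(ℝ, E) x x)) (fderiv ℝ (vecRep x V) (extChartAt 𝓘(ℝ, E) x x)) w =
      lieRep (fun y => (chartRep x (τ (q + 1)) y).curryLeft (vecRep x W y))
        (extChartAt 𝓘(ℝ, E) x x) (vecRep x V (extChartAt 𝓘(ℝ, E) x x))
        (fderiv ℝ (vecRep x V) (extChartAt 𝓘(ℝ, E) x x)) w := by
    rw [lieRep, h4.fderiv_eq, h4.eq_of_nhds, lieRep]
  rw [h6] at h3
  refine (chartRep_sub_apply _ _ q x _ w).trans ?_
  refine (congrArg₂ (· - ·) (h1.trans h8) (h2.trans h7)).trans ?_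
  exact h5.trans h3.symm

end

end Multisymplectic
namespace Multisymplectic

noncomputable section

variable {E : Type*} [NormedAddCommGroup E] [NormedSpace ℝ E] [FiniteDimensional ℝ E]
  {M : Type*} [TopologicalSpace M] [ChartedSpace E M] [IsManifold 𝓘(ℝ, E) ∞ M]

/-! ### Extension of alternating forms at a point -/

/-- The form which is constant in the chart at `x₀`, times a function. -/
def cutoffForm {p : ℕ} (x₀ : M) (ψ : M → ℝ) (a : E [⋀^Fin p]→L[ℝ] ℝ) (x : M) :
    TangentSpace 𝓘(ℝ, E) x [⋀^Fin p]→L[ℝ] ℝ :=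
  ψ x • a.compContinuousLinearMap (mfderiv 𝓘(ℝ, E) 𝓘(ℝ, E) (extChartAt 𝓘(ℝ, E) x₀) x :)

theorem chartRep_cutoffForm {p : ℕ} (x₀ : M) (ψ : M → ℝ) (a : E [⋀^Fin p]→L[ℝ] ℝ) (x₁ : M) {y : E}
    (hy : y ∈ (extChartAt 𝓘(ℝ, E) x₁).target)
    (hy' : (extChartAt 𝓘(ℝ, E) x₁).symm y ∈ (extChartAt 𝓘(ℝ, E) x₀).source) :
    chartRep x₁ (cutoffForm x₀ ψ a) y = ψ ((extChartAt 𝓘(ℝ, E) x₁).symm y) •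
      a.compContinuousLinearMap
        (fderiv ℝ (extChartAt 𝓘(ℝ, E) x₀ ∘ (extChartAt 𝓘(ℝ, E) x₁).symm) y) := by
  have h1 : MDifferentiableAt 𝓘(ℝ, E) 𝓘(ℝ, E) (extChartAt 𝓘(ℝ, E) x₀)
      ((extChartAt 𝓘(ℝ, E) x₁).symm y) :=
    (contMDiffAt_extChartAt' (n := ∞) (by simpa using hy')).mdifferentiableAt (by simp)
  have h2 : MDifferentiableAt 𝓘(ℝ, E) 𝓘(ℝ, E) (extChartAt 𝓘(ℝ, E) x₁).symm y :=
    ((contMDiffOn_extChartAt_symm (I := 𝓘(ℝ, E)) (n := ∞) x₁).contMDiffAt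
      ((isOpen_extChartAt_target (I := 𝓘(ℝ, E)) x₁).mem_nhds hy)).mdifferentiableAt (by simp)
  have h3 := mfderiv_comp y h1 h2
  rw [mfderiv_eq_fderiv] at h3
  rw [h3]
  rfl

/-- Inside the chart domain the form is `ψ` times the pullback of a constant form under a transition
map. At any other point `ψ` vanishes nearby, as its closed support lies in the domain. -/
theorem contMDiff_cutoffForm {p : ℕ} (x₀ : M) {ψ : M → ℝ} (hψ : ContMDiff 𝓘(ℝ, E) 𝓘(ℝ) ∞ ψ)
    (hs : tsupport ψ ⊆ (extChartAt 𝓘(ℝ, E) x₀).source) (a : E [⋀^Fin p]→L[ℝ] ℝ) :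
    ContMDiff 𝓘(ℝ, E) (𝓘(ℝ, E).prod 𝓘(ℝ, E [⋀^Fin p]→L[ℝ] ℝ)) ∞
      (fun x => Bundle.TotalSpace.mk' (E [⋀^Fin p]→L[ℝ] ℝ)
        (E := fun x : M => TangentSpace 𝓘(ℝ, E) x [⋀^Fin p]→L[ℝ] Bundle.Trivial M ℝ x)
        x (cutoffForm x₀ ψ a x)) := by
  rw [contMDiff_iff_chartRep]
  intro x₁
  have hy := mem_extChartAt_target (I := 𝓘(ℝ, E)) x₁
  by_cases hx : x₁ ∈ (extChartAt 𝓘(ℝ, E) x₀).source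
  · have hx' : (extChartAt 𝓘(ℝ, E) x₁).symm (extChartAt 𝓘(ℝ, E) x₁ x₁) ∈
        (extChartAt 𝓘(ℝ, E) x₀).source := by
      rwa [extChartAt_to_inv]
    have h1 : ContDiffAt ℝ ∞ (ψ ∘ (extChartAt 𝓘(ℝ, E) x₁).symm)
        (extChartAt 𝓘(ℝ, E) x₁ x₁) := by
      rw [← contMDiffAt_iff_contDiffAt]
      exact hψ.contMDiffAt.comp _
        ((contMDiffOn_extChartAt_symm (I := 𝓘(ℝ, E)) (n := ∞) x₁).contMDiffAt
          ((isOpen_extChartAt_target (I := 𝓘(ℝ, E)) x₁).mem_nhds hy))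
    have h2 := contDiffAt_comp_fderiv (F := fun _ => a) contDiffAt_const
      (contDiffAt_transition x₁ x₀ hy hx')
    refine (h1.smul h2).congr_of_eventuallyEq ?_
    filter_upwards [eventually_mem_source x₁ x₀ hy hx'] with z hz
    exact chartRep_cutoffForm x₀ ψ a x₁ hz.1 hz.2
  · have h1 : ∀ᶠ x in 𝓝 x₁, ψ x = 0 := by
      filter_upwards [(isClosed_tsupport ψ).isOpen_compl.mem_nhds fun h => hx (hs h)] with x h
      exact image_eq_zero_of_notMem_tsupport h
    have h2 : chartRep x₁ (cutoffForm x₀ ψ a) =ᶠ[𝓝 (extChartAt 𝓘(ℝ, E) x₁ x₁)] fun _ => 0 := by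
      filter_upwards [(tendsto_extChartAt_symm x₁).eventually h1] with y hy
      ext w
      change ψ _ * _ = 0
      rw [hy, zero_mul]
    exact contDiffAt_const.congr_of_eventuallyEq h2

/-- Every alternating form on a tangent space is the value of a smooth form. -/
theorem exists_form_eq [T2Space M] {p : ℕ} (x₀ : M)
    (a : TangentSpace 𝓘(ℝ, E) x₀ [⋀^Fin p]→L[ℝ] ℝ) : ∃ τ : Form E M p, τ x₀ = a := by
  let f : SmoothBumpFunction 𝓘(ℝ, E) x₀ := Classical.choice inferInstance
  let a' : E [⋀^Fin p]→L[ℝ] ℝ := a.compContinuousLinearMap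
    (mfderiv 𝓘(ℝ, E) 𝓘(ℝ, E) (extChartAt 𝓘(ℝ, E) x₀) x₀).inverse
  refine ⟨⟨cutoffForm x₀ f a', contMDiff_cutoffForm x₀ f.contMDiff
    f.tsupport_subset_extChartAt_source a'⟩, ?_⟩
  ext w
  change f x₀ * a (fun i => (mfderiv 𝓘(ℝ, E) 𝓘(ℝ, E) (extChartAt 𝓘(ℝ, E) x₀) x₀).inverse
    (mfderiv 𝓘(ℝ, E) 𝓘(ℝ, E) (extChartAt 𝓘(ℝ, E) x₀) x₀ (w i))) = a w
  rw [f.eq_one, one_mul]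
  congr 1
  funext i
  exact (isInvertible_mfderiv_extChartAt (mem_extChartAt_source x₀)).inverse_apply_self _

/-- The component of degree 0 of a contraction is the pairing itself, and smooth forms realise every
family of alternating forms at `x`. -/
theorem eq_of_contractAt_eq [T2Space M] {x : M} {X Y : ExteriorAlgebra ℝ (TangentSpace 𝓘(ℝ, E) x)}
    (h : ∀ (τ : Forms E M) (q : ℕ),
      contractAt X (fun p => τ p x) q = contractAt Y (fun p => τ p x) q) : X = Y := by
  refine eq_of_pairing_eq fun a => ?_
  choose τ hτ using fun p => exists_form_eq x (a p)
  have h1 := congrArg (fun g => g ![]) (h τ 0)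
  simp only [contractAt_apply, ExteriorAlgebra.ιMulti_zero_apply, mul_one] at h1
  rwa [show (fun p => τ p x) = a from funext hτ] at h1

theorem contract_injective [T2Space M] {j : ℕ} :
    Function.Injective (contract : MultiVec E M j → Module.End ℝ (Forms E M)) := by
  intro X Y h
  refine Subtype.ext (funext fun x => eq_of_contractAt_eq fun τ q => ?_)
  rw [← contract_apply_apply, ← contract_apply_apply, h]

/-! ### The Schouten bracket -/

/-- The operator by which the Schouten bracket of two multivector fields contracts. -/
def bracketOp (i j : ℕ) : MultiVec E M i →ₗ[ℝ] MultiVec E M j →ₗ[ℝ] Module.End ℝ (Forms E M) :=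
  LinearMap.mk₂ ℝ (fun X Y => derivedBracket Forms.d i j (contract X) (contract Y))
    (fun X X' Y => by
      simp only [derivedBracket, gradedLie, map_add, add_mul, mul_add, smul_add, smul_sub, sub_mul,
        mul_sub, mul_smul_comm, smul_mul_assoc]
      abel)
    (fun c X Y => by
      simp only [derivedBracket, gradedLie, map_smul, smul_sub, sub_mul,
        mul_sub, mul_smul_comm, smul_mul_assoc, smul_comm c])
    (fun X Y Y' => by
      simp only [derivedBracket, gradedLie, map_add, add_mul, mul_add, smul_add]
      abel)
    (fun c X Y => by
      simp only [derivedBracket, gradedLie, map_smul, smul_sub, sub_mul,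
        mul_sub, mul_smul_comm, smul_mul_assoc, smul_comm c])

theorem bracketOp_apply {i j : ℕ} (X : MultiVec E M i) (Y : MultiVec E M j) :
    bracketOp i j X Y = derivedBracket Forms.d i j (contract X) (contract Y) := rfl

theorem bracketOp_apply_apply {i j : ℕ} (X : MultiVec E M i) (Y : MultiVec E M j)
    (τ : Forms E M) : bracketOp i j X Y τ =
      (-1 : ℝ) ^ (i * (j + 1)) • lieDeriv X (contract Y τ) - contract Y (lieDeriv X τ) := rfl

theorem AgreeNear.lieDeriv {x₀ : M} {τ σ : Forms E M} (h : AgreeNear x₀ τ σ) {j : ℕ}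
    {X Y : MultiVec E M j} (hX : ∀ᶠ x in 𝓝 x₀, X.1 x = Y.1 x) :
    AgreeNear x₀ (lieDeriv X τ) (lieDeriv Y σ) := by
  rw [lieDeriv_apply, lieDeriv_apply]
  exact (h.contract hX).d.sub ((h.d.contract hX).smul _)

/-- The operator is built from `d` and contractions, which are local. Hence `X` and `Y` may be
replaced by finite sums of wedges, which are only given near a point. -/
theorem AgreeNear.bracketOp {x₀ : M} {i j : ℕ} {X X' : MultiVec E M i} {Y Y' : MultiVec E M j}
    (hX : ∀ᶠ x in 𝓝 x₀, X.1 x = X'.1 x) (hY : ∀ᶠ x in 𝓝 x₀, Y.1 x = Y'.1 x) (τ : Forms E M) :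
    AgreeNear x₀ (bracketOp i j X Y τ) (bracketOp i j X' Y' τ) := by
  have h : AgreeNear x₀ τ τ := Eventually.of_forall fun _ _ => rfl
  rw [bracketOp_apply_apply, bracketOp_apply_apply]
  exact (((h.contract hY).lieDeriv hX).smul _).sub ((h.lieDeriv hX).contract hY)

theorem wedgeField_list_sum {j : ℕ} (l : List (Fin (j + 1) → VecField E M)) (x : M) :
    (l.map wedgeField).sum.1 x = (l.map fun V => wedge V x).sum := by
  induction l with
  | nil => rfl
  | cons V l ih =>
    simp only [List.map_cons, List.sum_cons, ← ih]
    rfl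

/-- Contraction by the vector field and the two multivectors occurring in `schoutenWedge`. -/
theorem revProd_mul_revProd_mul_insert_apply {k l : ℕ} (c : VecField E M) (V : Fin k → VecField E M)
    (W : Fin l → VecField E M) (τ : Forms E M) (q : ℕ) (x : M) :
    (revProd (fun s => insert (W s)) * (revProd (fun s => insert (V s)) * insert c)) τ q x =
      contractAt (ExteriorAlgebra.ι ℝ (c x) * wedge V x * wedge W x) (fun p => τ p x) q := by
  rw [Module.End.mul_apply, Module.End.mul_apply, revProd_insert_apply]
  simp only [revProd_insert_apply, insert_apply_apply]
  rw [contractAt_contractAt, contractAt_contractAt, mul_assoc]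

/-- Evaluation of a form at a point on tangent vectors. -/
def Forms.eval (x : M) {q : ℕ} (w : Fin q → TangentSpace 𝓘(ℝ, E) x) : Forms E M →ₗ[ℝ] ℝ where
  toFun τ := τ q x w
  map_add' _ _ := rfl
  map_smul' _ _ := rfl

/-- Evaluation of a section of the exterior bundle at a point. -/
def MVSection.eval (x : M) : MVSection E M →ₗ[ℝ] ExteriorAlgebra ℝ (TangentSpace 𝓘(ℝ, E) x) where
  toFun X := X x
  map_add' _ _ := rfl
  map_smul' _ _ := rfl

theorem MVSection.eval_apply (x : M) (X : MVSection E M) : MVSection.eval x X = X x := rfl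

/-- Contraction and evaluation as a linear map on the exterior algebra. -/
def contractEval {x : M} (τ : Forms E M) {q : ℕ} (w : Fin q → TangentSpace 𝓘(ℝ, E) x) :
    ExteriorAlgebra ℝ (TangentSpace 𝓘(ℝ, E) x) →ₗ[ℝ] ℝ :=
  pairing (fun p => τ p x) ∘ₗ LinearMap.mulRight ℝ (ExteriorAlgebra.ιMulti ℝ q w)

theorem bracketOp_wedgeField {i j : ℕ} (V : Fin (i + 1) → VecField E M)
    (W : Fin (j + 1) → VecField E M) (τ : Forms E M) (q : ℕ) (x : M)
    (w : Fin q → TangentSpace 𝓘(ℝ, E) x) :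
    Forms.eval x w (bracketOp i j (wedgeField V) (wedgeField W) τ) =
      contractEval τ w (schoutenWedge V W x) := by
  rw [bracketOp_apply, contract_wedgeField, contract_wedgeField, derivedBracket,
    ← sum_sum_revProd_succAbove Forms.d (fun s => insert (V s)) (fun t => insert (W t))
      (fun s t => insert ((V s).bracket (W t))) (fun s t => insert_mul_insert _ _)
      (fun s t => gradedLie_insert_commutator _ _) (fun r s t => insert_mul_insert _ _)
      (fun r s t => insert_mul_insert _ _), schoutenWedge]
  simp only [LinearMap.sum_apply, map_sum, LinearMap.smul_apply, map_smul]
  refine Finset.sum_congr rfl fun s _ => Finset.sum_congr rfl fun t _ => ?_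
  congr 1
  exact congrArg (fun g => g w) (revProd_mul_revProd_mul_insert_apply _ _ _ τ q x)

/-- The Schouten bracket at a point of two sums of wedges of vector fields. -/
def schoutenAt {i j : ℕ} (l : List (Fin (i + 1) → VecField E M))
    (m : List (Fin (j + 1) → VecField E M)) : MVSection E M := fun x =>
  (l.map fun V => (m.map fun W => schoutenWedge V W x).sum).sum

/-- The lists do not occur on the right, so the pointwise bracket is independent of the chosen
decompositions. -/
theorem contractAt_schoutenAt {i j : ℕ} {X : MultiVec E M i} {Y : MultiVec E M j} {x₀ : M}
    {l : List (Fin (i + 1) → VecField E M)} {m : List (Fin (j + 1) → VecField E M)}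
    (hl : ∀ᶠ x in 𝓝 x₀, X.1 x = (l.map fun V => wedge V x).sum)
    (hm : ∀ᶠ x in 𝓝 x₀, Y.1 x = (m.map fun W => wedge W x).sum) (τ : Forms E M) (q : ℕ) :
    contractAt (schoutenAt l m x₀) (fun p => τ p x₀) q = bracketOp i j X Y τ q x₀ := by
  have h := (AgreeNear.bracketOp (X' := (l.map wedgeField).sum) (Y' := (m.map wedgeField).sum)
    (hl.mono fun x hx => hx.trans (wedgeField_list_sum l x).symm)
    (hm.mono fun x hx => hx.trans (wedgeField_list_sum m x).symm) τ).eq q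
  rw [h]
  ext w
  change contractEval τ w (schoutenAt l m x₀) = Forms.eval x₀ w (bracketOp i j _ _ τ)
  have h2 : ∀ (A : MultiVec E M i), bracketOp i j A (m.map wedgeField).sum =
      (m.map fun W => bracketOp i j A (wedgeField W)).sum := fun A => by
    rw [map_list_sum, List.map_map]
    rfl
  have h3 : bracketOp i j (l.map wedgeField).sum (m.map wedgeField).sum =
      (l.map fun V => (m.map fun W => bracketOp i j (wedgeField V) (wedgeField W)).sum).sum := by
    have : bracketOp i j (l.map wedgeField).sum (m.map wedgeField).sum =
      (bracketOp i j).flip (m.map wedgeField).sum (l.map wedgeField).sum := rfl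
    rw [this, map_list_sum, List.map_map]
    exact congrArg List.sum (List.map_congr_left fun V _ => h2 _)
  let ev : Module.End ℝ (Forms E M) →ₗ[ℝ] ℝ := Forms.eval x₀ w ∘ₗ LinearMap.applyₗ τ
  change _ = ev (bracketOp i j _ _)
  rw [h3, schoutenAt, map_list_sum, map_list_sum, List.map_map, List.map_map]
  refine congrArg List.sum (List.map_congr_left fun V _ => ?_)
  simp only [Function.comp_apply, map_list_sum, List.map_map]
  refine congrArg List.sum (List.map_congr_left fun W _ => ?_)
  exact (bracketOp_wedgeField V W τ q x₀ w).symm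

theorem schoutenWedge_mem {i j : ℕ} (V : Fin (i + 1) → VecField E M)
    (W : Fin (j + 1) → VecField E M) : schoutenWedge V W ∈ MultiVec E M (i + j) := by
  have h : schoutenWedge V W = ∑ a : Fin (i + 1), ∑ b : Fin (j + 1), (-1 : ℝ) ^ (a + b : ℕ) •
      (wedge (Fin.cons ((V a).bracket (W b)) (Fin.append (fun s => V (a.succAbove s))
        fun s => W (b.succAbove s)) : Fin (i + j + 1) → VecField E M) : MVSection E M) := by
    funext x
    refine Eq.trans ?_ (MVSection.eval_apply x _)
    simp only [map_sum, map_smul, schoutenWedge]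
    refine Finset.sum_congr rfl fun a _ => Finset.sum_congr rfl fun b _ => ?_
    congr 1
    rw [MVSection.eval_apply, wedge, wedge, wedge, ExteriorAlgebra.ιMulti_succ_apply, mul_assoc,
      ExteriorAlgebra.ιMulti_mul_ιMulti]
    congr 2
    funext s
    refine Fin.addCases (fun s => ?_) (fun s => ?_) s <;> simp [Matrix.vecTail]
  rw [h]
  exact sum_mem fun a _ => sum_mem fun b _ => Submodule.smul_mem _ _ (wedgeField _).2

theorem schoutenAt_mem {i j : ℕ} (l : List (Fin (i + 1) → VecField E M))
    (m : List (Fin (j + 1) → VecField E M)) : schoutenAt l m ∈ MultiVec E M (i + j) := by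
  have h : schoutenAt l m = (l.map fun V => (m.map fun W => schoutenWedge V W).sum).sum := by
    funext x
    refine Eq.trans ?_ (MVSection.eval_apply x _)
    simp only [map_list_sum, List.map_map, schoutenAt, Function.comp_def]
    rfl
  rw [h]
  refine list_sum_mem fun Z hZ => ?_
  obtain ⟨V, -, rfl⟩ := List.mem_map.1 hZ
  refine list_sum_mem fun Z hZ => ?_
  obtain ⟨W, -, rfl⟩ := List.mem_map.1 hZ
  exact schoutenWedge_mem V W

theorem exists_contract_eq_bracketOp [T2Space M] {i j : ℕ} (X : MultiVec E M i)
    (Y : MultiVec E M j) : ∃ Z : MultiVec E M (i + j), contract Z = bracketOp i j X Y := by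
  choose l hl using X.2
  choose m hm using Y.2
  have h : (fun x => schoutenAt (l x) (m x) x) ∈ MultiVec E M (i + j) := by
    intro x₀
    obtain ⟨r, hr⟩ := schoutenAt_mem (l x₀) (m x₀) x₀
    refine ⟨r, ?_⟩
    -- The section uses a different decomposition at each point. The one chosen at `x₀` is still
    -- valid around each nearby `x`, and both contract by the same operator there, so the section
    -- agrees near `x₀` with a smooth one.
    filter_upwards [hr, (hl x₀).eventually_nhds, (hm x₀).eventually_nhds] with x hx h1 h2
    rw [← hx]
    refine eq_of_contractAt_eq fun τ q => ?_
    rw [contractAt_schoutenAt (hl x) (hm x), contractAt_schoutenAt h1 h2]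
  refine ⟨⟨_, h⟩, ?_⟩
  ext τ : 1
  refine Forms.ext fun q x => ?_
  exact contractAt_schoutenAt (hl x) (hm x) τ q

/-- The multivector field underlying the Schouten bracket. -/
def schoutenField [T2Space M] {i j : ℕ} (X : MultiVec E M i) (Y : MultiVec E M j) :
    MultiVec E M (i + j) :=
  (exists_contract_eq_bracketOp X Y).choose

theorem contract_schoutenField [T2Space M] {i j : ℕ} (X : MultiVec E M i) (Y : MultiVec E M j) :
    contract (schoutenField X Y) = bracketOp i j X Y :=
  (exists_contract_eq_bracketOp X Y).choose_spec

/-- The Schouten bracket of two multivector fields. -/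
def schouten [T2Space M] (i j : ℕ) :
    MultiVec E M i →ₗ[ℝ] MultiVec E M j →ₗ[ℝ] MultiVec E M (i + j) :=
  -- `schoutenField` is a choice, but its contraction is bilinear and determines it.
  LinearMap.mk₂ ℝ schoutenField
    (fun X X' Y => contract_injective (by simp only [map_add, contract_schoutenField,
      LinearMap.add_apply]))
    (fun c X Y => contract_injective (by simp only [map_smul, contract_schoutenField,
      LinearMap.smul_apply]))
    (fun X Y Y' => contract_injective (by simp only [map_add, contract_schoutenField]))
    (fun c X Y => contract_injective (by simp only [map_smul, contract_schoutenField]))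

theorem contract_schouten [T2Space M] {i j : ℕ} (X : MultiVec E M i) (Y : MultiVec E M j) :
    contract (schouten i j X Y) = derivedBracket Forms.d i j (contract X) (contract Y) :=
  contract_schoutenField X Y

theorem isSchoutenBracket_schouten [T2Space M] :
    IsSchoutenBracket (schouten (E := E) (M := M)) := by
  intro i j X Y x₀ l m hl hm
  refine eq_of_contractAt_eq fun τ q => ?_
  rw [← contract_apply_apply, contract_schouten]
  exact (contractAt_schoutenAt hl hm τ q).symm

end

end Multisymplectic
namespace Multisymplectic

noncomputable section

/-! ### Transfer of graded Lie brackets along injections and surjections -/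

section GradedLie

variable {L L' : ℕ → Type*} [∀ i, AddCommGroup (L i)] [∀ i, Module ℝ (L i)]
  [∀ i, AddCommGroup (L' i)] [∀ i, Module ℝ (L' i)]
  {br : ∀ i j : ℕ, L i →ₗ[ℝ] L j →ₗ[ℝ] L (i + j)}
  {br' : ∀ i j : ℕ, L' i →ₗ[ℝ] L' j →ₗ[ℝ] L' (i + j)} (f : ∀ j, L' j →ₗ[ℝ] L j)

theorem IsGradedLieBracket.of_injective (h : IsGradedLieBracket br)
    (hf : ∀ j, Function.Injective (f j))
    (hbr : ∀ i j x y, f (i + j) (br' i j x y) = br i j (f i x) (f j y)) :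
    IsGradedLieBracket br' := by
  have hinj := (DirectSum.lmap_injective (f := f)).2 hf
  refine ⟨fun i j x y => hinj ?_, fun i j k x y z => hinj ?_⟩
  · simp only [map_neg, map_smul, DirectSum.lmap_of, hbr]
    exact h.1 i j _ _
  · simp only [map_add, map_smul, DirectSum.lmap_of, hbr, map_zero]
    exact h.2 i j k _ _ _

theorem IsGradedLieBracket.of_surjective (h : IsGradedLieBracket br')
    (hf : ∀ j, Function.Surjective (f j))
    (hbr : ∀ i j x y, f (i + j) (br' i j x y) = br i j (f i x) (f j y)) :
    IsGradedLieBracket br := by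
  refine ⟨fun i j x y => ?_, fun i j k x y z => ?_⟩
  · obtain ⟨x, rfl⟩ := hf i x
    obtain ⟨y, rfl⟩ := hf j y
    have := congrArg (DirectSum.lmap f) (h.1 i j x y)
    simpa only [map_neg, map_smul, DirectSum.lmap_of, hbr] using this
  · obtain ⟨x, rfl⟩ := hf i x
    obtain ⟨y, rfl⟩ := hf j y
    obtain ⟨z, rfl⟩ := hf k z
    have := congrArg (DirectSum.lmap f) (h.2 i j k x y z)
    simpa only [map_add, map_smul, DirectSum.lmap_of, hbr, map_zero] using this

end GradedLie

/-! ### Linear maps and bilinear maps on quotients -/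

section Quotients

variable {A B C Q R : Type*} [AddCommGroup A] [Module ℝ A] [AddCommGroup B] [Module ℝ B]
  [AddCommGroup C] [Module ℝ C] [AddCommGroup Q] [Module ℝ Q] [AddCommGroup R] [Module ℝ R]

theorem exists_linearEquiv_of_ker_eq {p : A →ₗ[ℝ] Q} {f : A →ₗ[ℝ] R} (hp : Function.Surjective p)
    (hf : Function.Surjective f) (h : LinearMap.ker p = LinearMap.ker f) :
    ∃ e : Q ≃ₗ[ℝ] R, ∀ a, e (p a) = f a := by
  refine ⟨(p.quotKerEquivOfSurjective hp).symm ≪≫ₗ Submodule.quotEquivOfEq _ _ h ≪≫ₗ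
    f.quotKerEquivOfSurjective hf, fun a => ?_⟩
  have : (p.quotKerEquivOfSurjective hp).symm (p a) = Submodule.Quotient.mk a := by
    rw [LinearEquiv.symm_apply_eq]
    rfl
  simp only [LinearEquiv.trans_apply, this]
  rfl

/-- Linear sections of `p` and `r` give the descended map; the two vanishing conditions make its
values independent of the sections. -/
theorem exists_bilinear_descent {p : A →ₗ[ℝ] Q} {r : B →ₗ[ℝ] R} (hp : Function.Surjective p)
    (hr : Function.Surjective r) (b : A →ₗ[ℝ] B →ₗ[ℝ] C) (h₁ : ∀ a y, p a = 0 → b a y = 0)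
    (h₂ : ∀ a y, r y = 0 → b a y = 0) :
    ∃ b' : Q →ₗ[ℝ] R →ₗ[ℝ] C, ∀ a y, b' (p a) (r y) = b a y := by
  obtain ⟨s, hs⟩ := p.exists_rightInverse_of_surjective (LinearMap.range_eq_top.2 hp)
  obtain ⟨t, ht⟩ := r.exists_rightInverse_of_surjective (LinearMap.range_eq_top.2 hr)
  refine ⟨b.compl₁₂ s t, fun a y => ?_⟩
  have e₁ : p (s (p a) - a) = 0 := by
    rw [map_sub, sub_eq_zero]
    exact LinearMap.congr_fun hs (p a)
  have e₂ : r (t (r y) - y) = 0 := by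
    rw [map_sub, sub_eq_zero]
    exact LinearMap.congr_fun ht (r y)
  have e₃ := h₁ _ (t (r y)) e₁
  have e₄ := h₂ a _ e₂
  rw [map_sub, LinearMap.sub_apply, sub_eq_zero] at e₃
  rw [map_sub, sub_eq_zero] at e₄
  rw [LinearMap.compl₁₂_apply, e₃, e₄]

end Quotients

/-! ### Graded commutativity of the exterior product -/

section ExteriorAlgebra

variable {V : Type*} [AddCommGroup V] [Module ℝ V]

theorem ι_mul_ιMulti (v : V) {l : ℕ} (w : Fin l → V) :
    ExteriorAlgebra.ι ℝ v * ExteriorAlgebra.ιMulti ℝ l w =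
      (-1 : ℝ) ^ l • (ExteriorAlgebra.ιMulti ℝ l w * ExteriorAlgebra.ι ℝ v) := by
  induction l with
  | zero => simp
  | succ l ih =>
    rw [ExteriorAlgebra.ιMulti_succ_apply, ← mul_assoc,
      eq_neg_of_add_eq_zero_left (ExteriorAlgebra.ι_add_mul_swap v (w 0)), neg_mul, mul_assoc, ih,
      mul_smul_comm, pow_succ, mul_neg_one, neg_smul, mul_assoc]

theorem ιMulti_mul_ιMulti_comm {k l : ℕ} (v : Fin k → V) (w : Fin l → V) :
    ExteriorAlgebra.ιMulti ℝ k v * ExteriorAlgebra.ιMulti ℝ l w =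
      (-1 : ℝ) ^ (k * l) • (ExteriorAlgebra.ιMulti ℝ l w * ExteriorAlgebra.ιMulti ℝ k v) := by
  induction k with
  | zero => simp
  | succ k ih =>
    rw [ExteriorAlgebra.ιMulti_succ_apply, mul_assoc, ih, mul_smul_comm, ← mul_assoc, ι_mul_ιMulti,
      smul_mul_assoc, smul_smul, mul_assoc, add_mul, pow_add, one_mul]

end ExteriorAlgebra

/-! ### Graded commutation of contractions and the Lie identities of the Schouten bracket -/

variable {E : Type*} [NormedAddCommGroup E] [NormedSpace ℝ E] [FiniteDimensional ℝ E]
  {M : Type*} [TopologicalSpace M] [ChartedSpace E M] [IsManifold 𝓘(ℝ, E) ∞ M]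

theorem MultiVec.apply_mem_span {j : ℕ} (X : MultiVec E M j) (x : M) :
    X.1 x ∈ Submodule.span ℝ (Set.range
      (ExteriorAlgebra.ιMulti ℝ (j + 1) (M := TangentSpace 𝓘(ℝ, E) x))) := by
  obtain ⟨l, hl⟩ := X.2 x
  rw [hl.self_of_nhds]
  refine list_sum_mem fun Z hZ => ?_
  obtain ⟨V, -, rfl⟩ := List.mem_map.1 hZ
  exact Submodule.subset_span ⟨_, rfl⟩

theorem MultiVec.mul_comm_apply {i j : ℕ} (X : MultiVec E M i) (Y : MultiVec E M j) (x : M) :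
    X.1 x * Y.1 x = (-1 : ℝ) ^ ((i + 1) * (j + 1)) • (Y.1 x * X.1 x) := by
  refine Submodule.span_induction₂ (p := fun A B _ _ =>
    A * B = (-1 : ℝ) ^ ((i + 1) * (j + 1)) • (B * A)) ?_ ?_ ?_ ?_ ?_ ?_ ?_
    (MultiVec.apply_mem_span X x) (MultiVec.apply_mem_span Y x)
  · rintro _ _ ⟨v, rfl⟩ ⟨w, rfl⟩
    exact ιMulti_mul_ιMulti_comm v w
  · intros
    simp
  · intros
    simp
  · intro a b c _ _ _ h1 h2
    rw [add_mul, mul_add c, h1, h2, smul_add]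
  · intro a b c _ _ _ h1 h2
    rw [mul_add, add_mul b, h1, h2, smul_add]
  · intro r a b _ _ h
    rw [smul_mul_assoc, h, mul_smul_comm, smul_comm]
  · intro r a b _ _ h
    rw [smul_mul_assoc, mul_smul_comm, h, smul_comm]

theorem contract_contract {i j : ℕ} (X : MultiVec E M i) (Y : MultiVec E M j) (τ : Forms E M) :
    contract X (contract Y τ) = (-1 : ℝ) ^ ((i + 1) * (j + 1)) • contract Y (contract X τ) := by
  refine Forms.ext fun q x => ?_
  change contractAt (X.1 x) (contractAt (Y.1 x) fun p => τ p x) q =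
    (-1 : ℝ) ^ ((i + 1) * (j + 1)) • contractAt (Y.1 x) (contractAt (X.1 x) fun p => τ p x) q
  rw [contractAt_contractAt, contractAt_contractAt, MultiVec.mul_comm_apply Y X, contractAt_smul_left,
    mul_comm (j + 1)]

theorem contract_mul_contract {i j : ℕ} (X : MultiVec E M i) (Y : MultiVec E M j) :
    (contract X * contract Y : Module.End ℝ (Forms E M)) =
      (-1 : ℝ) ^ ((i + 1) * (j + 1)) • (contract Y * contract X) :=
  LinearMap.ext fun τ => contract_contract X Y τ

/-- Pointwise `X` is a combination of wedges of `j + 1` vectors, which see no other component of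
`τ`. This carries the degree count, since `Forms` does not record degrees in its type. -/
theorem contract_apply_eq_zero {j q : ℕ} (X : MultiVec E M j) {τ : Forms E M}
    (h : τ (j + 1 + q) = 0) : contract X τ q = 0 := by
  ext x : 1
  ext w
  change pairing (fun p => τ p x) (X.1 x * ExteriorAlgebra.ιMulti ℝ q w) = 0
  refine Submodule.span_induction (p := fun A _ =>
    pairing (fun p => τ p x) (A * ExteriorAlgebra.ιMulti ℝ q w) = 0) ?_ ?_ ?_ ?_
    (MultiVec.apply_mem_span X x)
  · rintro _ ⟨v, rfl⟩
    have := contractAt_ιMulti v (fun p => τ p x) q w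
    rw [contractAt_apply] at this
    rw [this, h]
    rfl
  · simp
  · intro a b _ _ h1 h2
    rw [add_mul, map_add, h1, h2, add_zero]
  · intro r a _ h
    rw [smul_mul_assoc, map_smul, h, smul_zero]

theorem Forms.d_mul_d : (Forms.d * Forms.d : Module.End ℝ (Forms E M)) = 0 :=
  LinearMap.ext Forms.d_d

/-- The terms of the Lie identities lie in types indexed by different expressions for one degree.
This brings them to a common type, keeping both the class in the direct sum and the contraction. -/
theorem MultiVec.exists_of_eq {i j : ℕ} (h : i = j) (X : MultiVec E M i) :
    ∃ Y : MultiVec E M j, DirectSum.of (fun j => MultiVec E M j) i X =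
      DirectSum.of (fun j => MultiVec E M j) j Y ∧ contract X = contract Y := by
  subst h
  exact ⟨X, rfl, rfl⟩

theorem isGradedLieBracket_schouten [T2Space M] :
    IsGradedLieBracket (L := fun j => MultiVec E M j) schouten := by
  refine ⟨fun i j X Y => ?_, fun i j k X Y Z => ?_⟩
  · obtain ⟨A, h1, h2⟩ := MultiVec.exists_of_eq (add_comm j i) (schouten j i Y X)
    rw [h1, ← DirectSum.of_smul, ← map_neg]
    congr 1
    apply contract_injective
    rw [map_neg, map_smul, ← h2, contract_schouten, contract_schouten]
    exact derivedBracket_skew _ (contract_mul_contract X Y)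
  · obtain ⟨A, h1, h2⟩ := MultiVec.exists_of_eq (by omega : j + (k + i) = i + (j + k))
      (schouten j (k + i) Y (schouten k i Z X))
    obtain ⟨B, h3, h4⟩ := MultiVec.exists_of_eq (by omega : k + (i + j) = i + (j + k))
      (schouten k (i + j) Z (schouten i j X Y))
    rw [h1, h3, ← DirectSum.of_smul, ← DirectSum.of_smul, ← DirectSum.of_smul, ← map_add,
      ← map_add]
    refine (congrArg _ ?_).trans (map_zero _)
    apply contract_injective
    simp only [map_add, map_smul, map_zero, ← h2, ← h4, contract_schouten]
    refine derivedBracket_jacobi Forms.d_mul_d (contract_mul_contract Z X) ?_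
    -- The derived bracket is itself a contraction, hence commutes up to sign with that of `Z`.
    have := contract_mul_contract Z (schouten i j X Y)
    rwa [contract_schouten] at this

/-! ### Hamiltonian multivector fields and symmetries -/

theorem Forms.d_of_eq_zero {p : ℕ} {τ : Form E M p} (h : Form.d τ = 0) :
    Forms.d (Forms.of τ) = 0 := by
  funext q
  cases q with
  | zero => rfl
  | succ q =>
    change Form.d (Pi.single (M := fun p => Form E M p) p τ q) = 0
    by_cases hq : q = p
    · subst hq
      rw [Pi.single_eq_same, h]
    · rw [Pi.single_eq_of_ne hq, map_zero]

/-- If `dθ = 0` then `L_X θ = d(X ⌟ θ)`, which is exact and in particular closed. -/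
theorem lieDeriv_mem_forms (t : Kind) {j : ℕ} (X : MultiVec E M j) {θ : Forms E M}
    (h : θ ∈ t.forms) : lieDeriv X θ ∈ t.forms := by
  cases t with
  | loc =>
    have h' : Forms.d θ = 0 := h
    change Forms.d (lieDeriv X θ) = 0
    rw [lieDeriv_apply, h', map_zero, smul_zero, sub_zero, Forms.d_d]
  | glob =>
    obtain ⟨σ, rfl⟩ := h
    refine ⟨contract X (Forms.d σ), ?_⟩
    rw [lieDeriv_apply, Forms.d_d, map_zero, smul_zero, sub_zero]
  | str =>
    have h' : θ = 0 := h
    rw [h', map_zero]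
    exact zero_mem _

theorem range_d_le_forms {t : Kind} (ht : t = Kind.glob ∨ t = Kind.loc) :
    LinearMap.range (Forms.d (E := E) (M := M)) ≤ t.forms := by
  rcases ht with rfl | rfl
  · exact le_rfl
  · rintro _ ⟨σ, rfl⟩
    exact Forms.d_d σ

theorem lieDeriv_schouten [T2Space M] {i j : ℕ} (X : MultiVec E M i) (Y : MultiVec E M j)
    (τ : Forms E M) : lieDeriv (schouten i j X Y) τ =
      (-1 : ℝ) ^ (i * j) • lieDeriv X (lieDeriv Y τ) - lieDeriv Y (lieDeriv X τ) := by
  have h := gradedLie_derivedBracket Forms.d_mul_d i j (contract X) (contract Y)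
  rw [← contract_schouten] at h
  exact LinearMap.congr_fun h τ

/-! ### Hamiltonian fields, symmetries and conserved quantities -/

namespace MultiHamiltonianSystem

variable {n : ℕ} (sys : MultiHamiltonianSystem E M n)

theorem d_plecticForm : Forms.d sys.plecticForm = 0 := Forms.d_of_eq_zero sys.closed

theorem plecticForm_apply_of_ne {p : ℕ} (h : p ≠ n + 1) : sys.plecticForm p = 0 :=
  Pi.single_eq_of_ne (M := fun p => Form E M p) h _

theorem d_contract_plecticForm {j : ℕ} {X : MultiVec E M j} (hX : X ∈ sys.hamiltonianFields j) :
    Forms.d (contract X sys.plecticForm) = 0 := by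
  obtain ⟨σ, hσ⟩ := hX
  rw [← hσ, Forms.d_d]

theorem mem_hamiltonianFields {j : ℕ} {α : Forms E M} {X : MultiVec E M j}
    (h : sys.IsHamiltonianField α X) : X ∈ sys.hamiltonianFields j :=
  ⟨-α, by rw [map_neg, h, neg_neg]⟩

/-- Since `ω`, `X ⌟ ω` and `Y ⌟ ω` are closed, `L_X ω = 0` and `L_X (Y ⌟ ω) = d(X ⌟ Y ⌟ ω)`. Only
this last term of the bracket formula survives. -/
theorem contract_schouten_plecticForm [T2Space M] {i j : ℕ} {X : MultiVec E M i}
    {Y : MultiVec E M j} (hX : X ∈ sys.hamiltonianFields i) (hY : Y ∈ sys.hamiltonianFields j) :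
    contract (schouten i j X Y) sys.plecticForm =
      (-1 : ℝ) ^ (j + 1) • Forms.d (contract Y (contract X sys.plecticForm)) := by
  rw [contract_schouten, ← bracketOp_apply, bracketOp_apply_apply, lieDeriv_apply, lieDeriv_apply,
    sys.d_plecticForm, sys.d_contract_plecticForm hX, sys.d_contract_plecticForm hY,
    contract_contract X Y]
  simp only [map_zero, smul_zero, sub_zero, map_smul, smul_smul, ← pow_add]
  congr 1
  -- The exponents add up to `(i + (i + 1)) (j + 1)`, whose first factor is odd.
  rw [← add_mul, pow_mul, Odd.neg_one_pow ⟨i, by ring⟩]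

theorem schouten_mem_hamiltonianFields [T2Space M] {i j : ℕ} {X : MultiVec E M i}
    {Y : MultiVec E M j} (hX : X ∈ sys.hamiltonianFields i) (hY : Y ∈ sys.hamiltonianFields j) :
    schouten i j X Y ∈ sys.hamiltonianFields (i + j) :=
  ⟨(-1 : ℝ) ^ (j + 1) • contract Y (contract X sys.plecticForm), by
    rw [map_smul, sys.contract_schouten_plecticForm hX hY]⟩

theorem schouten_mem_symmetries [T2Space M] {t : Kind} {i j : ℕ} {X : MultiVec E M i}
    {Y : MultiVec E M j} (hX : X ∈ sys.symmetries t i) (hY : Y ∈ sys.symmetries t j) :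
    schouten i j X Y ∈ sys.symmetries t (i + j) := by
  refine ⟨sys.schouten_mem_hamiltonianFields hX.1 hY.1, ?_⟩
  rw [lieDeriv_schouten]
  exact sub_mem (Submodule.smul_mem _ _ (lieDeriv_mem_forms t X hY.2))
    (lieDeriv_mem_forms t Y hX.2)

theorem isHamiltonianField_poissonBracket [T2Space M] {i j : ℕ} {X : MultiVec E M i}
    {Y : MultiVec E M j} (hX : X ∈ sys.hamiltonianFields i) (hY : Y ∈ sys.hamiltonianFields j) :
    sys.IsHamiltonianField (sys.poissonBracket X Y) (schouten i j X Y) := by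
  rw [IsHamiltonianField, poissonBracket, sys.contract_schouten_plecticForm hX hY, map_smul,
    pow_succ, mul_neg_one, neg_smul]

theorem poissonBracket_apply_of_ne {i j p : ℕ} (X : MultiVec E M i) (Y : MultiVec E M j)
    (hp : p + (i + j + 1) ≠ n) : sys.poissonBracket X Y p = 0 := by
  have h : contract Y (contract X sys.plecticForm) p = 0 :=
    contract_apply_eq_zero _ (contract_apply_eq_zero _ (sys.plecticForm_apply_of_ne (by omega)))
  rw [poissonBracket, Forms.smul_apply, h]
  exact smul_zero (A := Form E M p) ((-1 : ℝ) ^ (j + 1 + 1))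

/-- The terms with `dα` and `dH` are double contractions of `ω` by `X` and `X_H` in opposite orders,
and they cancel. The remainder is exact but need not vanish, so the comparison is made for the local
and global notions. -/
theorem lieDeriv_add_lieDeriv_mem {j : ℕ} {α : Forms E M} {X : MultiVec E M j}
    (h : sys.IsHamiltonianField α X) :
    lieDeriv sys.XH α + lieDeriv X sys.hamiltonianForm ∈ LinearMap.range (Forms.d (E := E)) := by
  have hH : contract sys.XH sys.plecticForm = -Forms.d sys.hamiltonianForm := by
    rw [hamiltonianForm, sys.hamiltonian, neg_neg]
    rfl
  refine ⟨contract sys.XH α + contract X sys.hamiltonianForm, ?_⟩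
  rw [lieDeriv_apply, lieDeriv_apply, h, map_neg, contract_contract, hH]
  simp only [map_add, map_neg, zero_add, one_mul, pow_one, neg_smul, one_smul, smul_neg, neg_neg]
  abel

theorem mem_symmetries_of_mem_conserved {t : Kind} (ht : t = Kind.glob ∨ t = Kind.loc) {j : ℕ}
    {α : Forms E M} (hα : α ∈ sys.conserved t j) {X : MultiVec E M j}
    (h : sys.IsHamiltonianField α X) : X ∈ sys.symmetries t j := by
  refine ⟨sys.mem_hamiltonianFields h, ?_⟩
  have h1 := range_d_le_forms ht (sys.lieDeriv_add_lieDeriv_mem h)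
  exact (Submodule.add_mem_iff_right _ hα.2.2).1 h1

theorem mem_conserved_of_mem_symmetries {t : Kind} (ht : t = Kind.glob ∨ t = Kind.loc) {j : ℕ}
    {α : Forms E M} {X : MultiVec E M j} (hX : X ∈ sys.symmetries t j)
    (h : sys.IsHamiltonianField α X) (hα : ∀ p, p + (j + 1) ≠ n → α p = 0) :
    α ∈ sys.conserved t j :=
  ⟨hα, ⟨X, h⟩, (Submodule.add_mem_iff_left _ hX.2).1
    (range_d_le_forms ht (sys.lieDeriv_add_lieDeriv_mem h))⟩

theorem exists_isHamiltonianField {j : ℕ} {X : MultiVec E M j} (hX : X ∈ sys.hamiltonianFields j) :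
    ∃ α : Forms E M, (∀ p, p + (j + 1) ≠ n → α p = 0) ∧ sys.IsHamiltonianField α X := by
  obtain ⟨σ, hσ⟩ := hX
  classical
  -- The primitive `σ` may have components in other degrees. They are closed, because `X ⌟ ω` is
  -- concentrated in one degree, and can be dropped. If `j + 1 > n` nothing is kept, and `X ⌟ ω` is
  -- zero.
  refine ⟨fun p => if p + (j + 1) = n then -σ p else 0, fun p hp => if_neg hp, ?_⟩
  refine Eq.trans ?_ (congrArg Neg.neg hσ)
  funext q
  cases q with
  | zero => exact (neg_zero (G := Form E M 0)).symm
  | succ p =>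
    change Form.d (if p + (j + 1) = n then -σ p else 0) = -Form.d (σ p)
    split_ifs with hp
    · exact map_neg Form.d (σ p)
    · have h1 : contract X sys.plecticForm (p + 1) = 0 :=
        contract_apply_eq_zero _ (sys.plecticForm_apply_of_ne (by omega))
      have h2 : Form.d (σ p) = 0 := (congrFun hσ (p + 1)).trans h1
      rw [h2, map_zero, neg_zero]

theorem symmetryClass_surjective (t : Kind) (j : ℕ) :
    Function.Surjective (sys.symmetryClass t j) := Submodule.mkQ_surjective _

theorem conservedClass_surjective (t : Kind) (j : ℕ) :
    Function.Surjective (sys.conservedClass t j) := Submodule.mkQ_surjective _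

theorem symmetryClass_eq_zero_iff {t : Kind} {j : ℕ} (X : sys.symmetries t j) :
    sys.symmetryClass t j X = 0 ↔ contract X.1 sys.plecticForm = 0 :=
  Submodule.Quotient.mk_eq_zero _

theorem conservedClass_eq_zero_iff {t : Kind} {j : ℕ} (α : sys.conserved t j) :
    sys.conservedClass t j α = 0 ↔ Forms.d α.1 = 0 :=
  Submodule.Quotient.mk_eq_zero _

theorem symmetryClass_eq_iff {t : Kind} {j : ℕ} (X Y : sys.symmetries t j) :
    sys.symmetryClass t j X = sys.symmetryClass t j Y ↔
      contract X.1 sys.plecticForm = contract Y.1 sys.plecticForm := by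
  rw [← sub_eq_zero, ← map_sub, symmetryClass_eq_zero_iff, Submodule.coe_sub, map_sub,
    LinearMap.sub_apply, sub_eq_zero]

/-- A Hamiltonian multivector field of a conserved quantity. -/
def symmetryOf {t : Kind} (ht : t = Kind.glob ∨ t = Kind.loc) {j : ℕ} (α : sys.conserved t j) :
    sys.symmetries t j :=
  ⟨α.2.2.1.choose, sys.mem_symmetries_of_mem_conserved ht α.2 α.2.2.1.choose_spec⟩

theorem isHamiltonianField_symmetryOf {t : Kind} (ht : t = Kind.glob ∨ t = Kind.loc) {j : ℕ}
    (α : sys.conserved t j) : sys.IsHamiltonianField α.1 (sys.symmetryOf ht α).1 :=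
  α.2.2.1.choose_spec

theorem contract_symmetryOf {t : Kind} (ht : t = Kind.glob ∨ t = Kind.loc) {j : ℕ}
    (α : sys.conserved t j) :
    contract (sys.symmetryOf ht α).1 sys.plecticForm = -Forms.d α.1 := by
  rw [sys.isHamiltonianField_symmetryOf ht α, neg_neg]

/-- The map which sends a conserved quantity to the class of its Hamiltonian multivector fields. -/
def toSymmetryQuot {t : Kind} (ht : t = Kind.glob ∨ t = Kind.loc) (j : ℕ) :
    sys.conserved t j →ₗ[ℝ] sys.SymmetryQuot t j where
  toFun α := sys.symmetryClass t j (sys.symmetryOf ht α)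
  -- The choice of Hamiltonian field is not linear in `α`, but its contraction with `ω` is `-dα`,
  -- and that fixes the class.
  map_add' α β := by
    rw [← map_add, symmetryClass_eq_iff, Submodule.coe_add, map_add, LinearMap.add_apply]
    simp only [contract_symmetryOf, Submodule.coe_add, map_add, neg_add]
  map_smul' c α := by
    rw [RingHom.id_apply, ← map_smul, symmetryClass_eq_iff, Submodule.coe_smul, map_smul,
      LinearMap.smul_apply]
    simp only [contract_symmetryOf, Submodule.coe_smul, map_smul, smul_neg]

theorem toSymmetryQuot_apply {t : Kind} (ht : t = Kind.glob ∨ t = Kind.loc) {j : ℕ}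
    (α : sys.conserved t j) (X : sys.symmetries t j) (h : sys.IsHamiltonianField α.1 X.1) :
    sys.toSymmetryQuot ht j α = sys.symmetryClass t j X := by
  refine (sys.symmetryClass_eq_iff _ _).2 ?_
  rw [contract_symmetryOf, h, neg_neg]

theorem exists_conservedQuot_equiv {t : Kind} (ht : t = Kind.glob ∨ t = Kind.loc) (j : ℕ) :
    ∃ e : sys.ConservedQuot t j ≃ₗ[ℝ] sys.SymmetryQuot t j,
      ∀ α, e (sys.conservedClass t j α) = sys.toSymmetryQuot ht j α := by
  refine exists_linearEquiv_of_ker_eq (sys.conservedClass_surjective t j) ?_ ?_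
  · intro s
    obtain ⟨X, rfl⟩ := sys.symmetryClass_surjective t j s
    obtain ⟨α, hα, h⟩ := sys.exists_isHamiltonianField X.2.1
    exact ⟨⟨α, sys.mem_conserved_of_mem_symmetries ht X.2 h hα⟩,
      sys.toSymmetryQuot_apply ht _ X h⟩
  · ext α
    rw [LinearMap.mem_ker, LinearMap.mem_ker, conservedClass_eq_zero_iff]
    refine Iff.trans ?_ (sys.symmetryClass_eq_zero_iff (sys.symmetryOf ht α)).symm
    rw [contract_symmetryOf, neg_eq_zero]

/-- The Schouten bracket on the symmetries of a given kind. -/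
def symmetryBracket [T2Space M] (t : Kind) (i j : ℕ) :
    sys.symmetries t i →ₗ[ℝ] sys.symmetries t j →ₗ[ℝ] sys.symmetries t (i + j) :=
  LinearMap.mk₂ ℝ (fun X Y => ⟨schouten i j X.1 Y.1, sys.schouten_mem_symmetries X.2 Y.2⟩)
    (fun X X' Y => Subtype.ext (by simp))
    (fun c X Y => Subtype.ext (by simp))
    (fun X Y Y' => Subtype.ext (by simp))
    (fun c X Y => Subtype.ext (by simp))

/-- The contraction of `ω` by the bracket is `± d(Y ⌟ X ⌟ ω)`, which vanishes as soon as `X` or `Y`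
annihilates `ω`. -/
theorem exists_symmetryQuot_bracket [T2Space M] (t : Kind) (i j : ℕ) :
    ∃ B : sys.SymmetryQuot t i →ₗ[ℝ] sys.SymmetryQuot t j →ₗ[ℝ] sys.SymmetryQuot t (i + j),
      ∀ X Y, B (sys.symmetryClass t i X) (sys.symmetryClass t j Y) =
        sys.symmetryClass t (i + j) (sys.symmetryBracket t i j X Y) := by
  have h0 : ∀ (X : sys.symmetries t i) (Y : sys.symmetries t j),
      contract Y.1 (contract X.1 sys.plecticForm) = 0 →
      ((sys.symmetryBracket t i j).compr₂ (sys.symmetryClass t (i + j))) X Y = 0 := by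
    intro X Y h
    rw [LinearMap.compr₂_apply, symmetryClass_eq_zero_iff]
    refine (sys.contract_schouten_plecticForm X.2.1 Y.2.1).trans ?_
    rw [h, map_zero, smul_zero]
  refine exists_bilinear_descent (sys.symmetryClass_surjective t i)
    (sys.symmetryClass_surjective t j)
    ((sys.symmetryBracket t i j).compr₂ (sys.symmetryClass t (i + j)))
    (fun X Y h => h0 X Y ?_) (fun X Y h => h0 X Y ?_)
  · rw [(sys.symmetryClass_eq_zero_iff X).1 h, map_zero]
  · rw [contract_contract, (sys.symmetryClass_eq_zero_iff Y).1 h, map_zero, smul_zero]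

end MultiHamiltonianSystem

end

end Multisymplectic

/-! ### The theorem -/

theorem mainTheorem10 {E : Type*} [NormedAddCommGroup E] [NormedSpace ℝ E]
    [FiniteDimensional ℝ E] {M : Type*} [TopologicalSpace M] [T2Space M]
    [SigmaCompactSpace M] [ChartedSpace E M] [IsManifold 𝓘(ℝ, E) ∞ M] {n : ℕ} (hn : 1 ≤ n)
    (sys : MultiHamiltonianSystem E M n) :
    ∃ br : ∀ i j : ℕ, MultiVec E M i →ₗ[ℝ] MultiVec E M j →ₗ[ℝ] MultiVec E M (i + j),
      IsSchoutenBracket br ∧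
      IsGradedLieBracket (L := fun j => MultiVec E M j) br ∧
      (∀ (i j : ℕ) (X : MultiVec E M i) (Y : MultiVec E M j),
        X ∈ sys.hamiltonianFields i → Y ∈ sys.hamiltonianFields j →
          br i j X Y ∈ sys.hamiltonianFields (i + j)) ∧
      (∀ (t : Kind) (i j : ℕ) (X : MultiVec E M i) (Y : MultiVec E M j),
        X ∈ sys.symmetries t i → Y ∈ sys.symmetries t j →
          br i j X Y ∈ sys.symmetries t (i + j)) ∧
      ∀ t : Kind, t = Kind.glob ∨ t = Kind.loc →
        ∃ (P : ∀ i j : ℕ, sys.ConservedQuot t i →ₗ[ℝ] sys.ConservedQuot t j →ₗ[ℝ]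
            sys.ConservedQuot t (i + j))
          (B : ∀ i j : ℕ, sys.SymmetryQuot t i →ₗ[ℝ] sys.SymmetryQuot t j →ₗ[ℝ]
            sys.SymmetryQuot t (i + j))
          (Φ : ∀ j : ℕ, sys.ConservedQuot t j ≃ₗ[ℝ] sys.SymmetryQuot t j),
          IsGradedLieBracket P ∧
          (∀ (i j : ℕ) (α : sys.conserved t i) (β : sys.conserved t j)
            (Xα : MultiVec E M i) (Xβ : MultiVec E M j),
            sys.IsHamiltonianField α.1 Xα → sys.IsHamiltonianField β.1 Xβ →
              ∃ h : sys.poissonBracket Xα Xβ ∈ sys.conserved t (i + j),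
                P i j (sys.conservedClass t i α) (sys.conservedClass t j β) =
                  sys.conservedClass t (i + j) ⟨_, h⟩) ∧
          IsGradedLieBracket B ∧
          (∀ (i j : ℕ) (X : sys.symmetries t i) (Y : sys.symmetries t j),
            ∃ h : br i j X.1 Y.1 ∈ sys.symmetries t (i + j),
              B i j (sys.symmetryClass t i X) (sys.symmetryClass t j Y) =
                sys.symmetryClass t (i + j) ⟨_, h⟩) ∧
          (∀ (j : ℕ) (α : sys.conserved t j) (X : MultiVec E M j),
            sys.IsHamiltonianField α.1 X →
              ∃ h : X ∈ sys.symmetries t j,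
                Φ j (sys.conservedClass t j α) = sys.symmetryClass t j ⟨X, h⟩) ∧
          ∀ (i j : ℕ) (a : sys.ConservedQuot t i) (b : sys.ConservedQuot t j),
            Φ (i + j) (P i j a b) = B i j (Φ i a) (Φ j b) := by
  refine ⟨schouten, isSchoutenBracket_schouten, isGradedLieBracket_schouten,
    fun i j X Y hX hY => sys.schouten_mem_hamiltonianFields hX hY,
    fun t i j X Y hX hY => sys.schouten_mem_symmetries hX hY, fun t ht => ?_⟩
  choose B hB using sys.exists_symmetryQuot_bracket t
  choose Φ hΦ using sys.exists_conservedQuot_equiv ht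
  -- The Lie identities pass from all multivector fields to the symmetries by inclusion, then to the
  -- quotient by projection.
  have hBLie : IsGradedLieBracket B :=
    (isGradedLieBracket_schouten.of_injective (br' := sys.symmetryBracket t)
      (fun j => (sys.symmetries t j).subtype) (fun j => Subtype.val_injective)
      fun _ _ _ _ => rfl).of_surjective (sys.symmetryClass t) (sys.symmetryClass_surjective t)
      fun i j X Y => (hB i j X Y).symm
  have hΦX : ∀ (j : ℕ) (α : sys.conserved t j) (X : sys.symmetries t j),
      sys.IsHamiltonianField α.1 X.1 →
        Φ j (sys.conservedClass t j α) = sys.symmetryClass t j X := fun j α X h =>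
    (hΦ j α).trans (sys.toSymmetryQuot_apply ht α X h)
  -- The bracket on conserved classes is `B` transported through `Φ`, so it is a graded Lie bracket
  -- and `Φ` a homomorphism by construction. It remains to identify it with the Poisson bracket.
  refine ⟨fun i j => ((B i j).compl₁₂ (Φ i).toLinearMap (Φ j).toLinearMap).compr₂
    (Φ (i + j)).symm.toLinearMap, B, Φ, ?_, ?_, hBLie, ?_, ?_, ?_⟩
  · exact hBLie.of_injective (fun j => (Φ j).toLinearMap) (fun j => (Φ j).injective)
      fun i j a b => (Φ (i + j)).apply_symm_apply _
  · intro i j α β X Y hX hY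
    have hXs := sys.mem_symmetries_of_mem_conserved ht α.2 hX
    have hYs := sys.mem_symmetries_of_mem_conserved ht β.2 hY
    have hp := sys.isHamiltonianField_poissonBracket hXs.1 hYs.1
    have hs := sys.schouten_mem_symmetries hXs hYs
    have hc := sys.mem_conserved_of_mem_symmetries ht hs hp
      fun p => sys.poissonBracket_apply_of_ne X Y
    -- Under `Φ` both sides become the class of the Schouten bracket of `X` and `Y`, a Hamiltonian
    -- field of the Poisson bracket by `hp`.
    refine ⟨hc, (Φ (i + j)).injective ?_⟩
    refine ((Φ (i + j)).apply_symm_apply _).trans ?_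
    refine (congrArg₂ (fun a b => B i j a b) (hΦX i α ⟨X, hXs⟩ hX) (hΦX j β ⟨Y, hYs⟩ hY)).trans ?_
    rw [hB, hΦX _ ⟨_, hc⟩ ⟨_, hs⟩ hp]
    rfl
  · exact fun i j X Y => ⟨sys.schouten_mem_symmetries X.2 Y.2, hB i j X Y⟩
  · intro j α X h
    exact ⟨sys.mem_symmetries_of_mem_conserved ht α.2 h, hΦX j α ⟨X, _⟩ h⟩
  · exact fun i j a b => (Φ (i + j)).apply_symm_apply _
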